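/- Let $m$ and $n$ be positive integers and let $d = \gcd(m, n)$. The $m \times n$ grid is the plane graph whose vertices are the integer points $(x, y)$ with $1 \le x \le m$ and $1 \le y \le n$ and whose edges are the unit segments between these points; its cells are the unit squares bounded by its edges. The signature of a cycle $C$ in the grid is the function which assigns to each cell the number of edges of that cell which belong to $C$. Every cycle on the $m \times n$ grid is uniquely determined by its signature (that is, any two cycles on the grid with the same signature coincide) if and only if $m$ and $n$ satisfy one or more of the following conditions: (a) $m \le 2$ or $n \le 2$; (b) $d = 1$; (c) $d = 2$ and $m \equiv n \equiv 2 \pmod 4$. Conversely, there exist two distinct cycles on the $m \times n$ grid with the same signature if and only if $m$ and $n$ satisfy all three of the following conditions: (a$'$) $m \ge 3$ and $n \ge 3$; (b$'$) $d \ge 2$; (c$'$) if $d = 2$, then $m \equiv 0 \pmod 4$ or $n \equiv 0 \pmod 4$. -/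

import Mathlib

namespace Slitherlink

/-- The square lattice: two integer points are adjacent when they are the endpoints of a unit
segment. -/
def lattice : SimpleGraph (ℤ × ℤ) where
  Adj p q :=
    (p.1 = q.1 ∧ (p.2 = q.2 + 1 ∨ q.2 = p.2 + 1)) ∨
      (p.2 = q.2 ∧ (p.1 = q.1 + 1 ∨ q.1 = p.1 + 1))
  symm := ⟨fun p q h => by omega⟩
  loopless := ⟨fun p h => by omega⟩

/-- The grid of size `m × n`, counted by vertices: its vertices are the integer points `(x, y)`
with `1 ≤ x ≤ m` and `1 ≤ y ≤ n`, and its edges are the unit segments between these points. -/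
def grid (m n : ℕ) : lattice.Subgraph :=
  (⊤ : lattice.Subgraph).induce {p | 1 ≤ p.1 ∧ p.1 ≤ m ∧ 1 ≤ p.2 ∧ p.2 ≤ n}

/-- `C` is a cycle in the `m × n` grid: it is a subgraph of the grid, and it consists of the
vertices and the edges of a closed walk which is a cycle. -/
def IsGridCycle (m n : ℕ) (C : lattice.Subgraph) : Prop :=
  C ≤ grid m n ∧ ∃ (v : ℤ × ℤ) (w : lattice.Walk v v), w.IsCycle ∧ w.toSubgraph = C

/-- The cells (the finite faces) of the `m × n` grid; each unit square is represented by its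
lower left vertex. -/
def cells (m n : ℕ) : Set (ℤ × ℤ) :=
  {c | 1 ≤ c.1 ∧ c.1 + 1 ≤ m ∧ 1 ≤ c.2 ∧ c.2 + 1 ≤ n}

/-- The lower, upper, left and right edges of the cell with lower left vertex `c`. -/
def cellEdges (c : ℤ × ℤ) : Set (Sym2 (ℤ × ℤ)) :=
  {s((c.1, c.2), (c.1 + 1, c.2)), s((c.1, c.2 + 1), (c.1 + 1, c.2 + 1)),
    s((c.1, c.2), (c.1, c.2 + 1)), s((c.1 + 1, c.2), (c.1 + 1, c.2 + 1))}

/-- The signature of `C` in the `m × n` grid: it assigns to each cell the number of edges of that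
cell which belong to `C`. -/
noncomputable def signature (m n : ℕ) (C : lattice.Subgraph) : cells m n → ℕ :=
  fun c => (cellEdges c ∩ C.edgeSet).ncard

end Slitherlink

/-! Uniqueness. A cycle is encoded by the indicator `g` of its enclosed cells modulo 2, an edge
lying on the cycle exactly when the cells on its two sides differ. Modulo 2 the number of cycle
edges around a cell is the sum of `g` over the four neighbouring cells. Hence for two cycles with
the same signature the sum of the two indicators vanishes outside the grid and satisfies a discrete
wave equation on the cells. Reflecting in the sides extends it to the plane
(`exists_wave_extension`); signs play no role modulo 2. The extension is symmetric in the two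
coordinates, so it has both periods `2m` and `2n` in `x`, hence period `2d`. If `d = 1` this forces
it to vanish. If `d = 2` it is constant on the cells with both coordinates odd and zero on all
others.

In the remaining case two distinct cycles differ at all odd-odd cells, whose vertex sets partition
the grid into `PQ` blocks of four, with `m = 2P` and `n = 2Q`. The signatures agree as integers only
if exactly two of the four neighbours of each such cell are enclosed. Orient both cycles with the
interior on the left and view them as permutations of the grid vertices. Each is a single cycle of
even length, since the lattice is bipartite, so both are odd. They differ by a product of
permutations of the blocks: a transposition if the two enclosed neighbours are opposite, a 3-cycle
if they are adjacent. Comparing signs, the number of blocks of the first kind is even. A block of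
the second kind has exactly one vertex off the cycle and one of the first kind has none, so the
evenness of the length makes the number of blocks of the second kind even too. Thus `PQ` is even
(`even_mul_of_squares`), which is impossible for `m ≡ n ≡ 2 (mod 4)`.

Existence. A pair of cycles with equal signatures can be glued to its mirror image with the two
cycles exchanged: the differences on the two sides of the seam cancel, and merging along an edge
common to both cycles leaves a single cycle each time. Iterating in both directions tiles larger
grids (`Ambiguous.tile`). The building blocks are `4 × 4` and `6 × 4` examples for `d` a power of
two, and, for every odd `e ≥ 3`, a pair in the `e × e` grid whose difference is carried by the sides
of the diagonal cells (`exists_diagonalPair`). -/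

namespace Slitherlink

/-! ### Edges, cell sums and vertex degrees -/

/-- The edge from `(x, y)` to `(x + 1, y)`. -/
def hEdge (x y : ℤ) : Sym2 (ℤ × ℤ) := s((x, y), (x + 1, y))

/-- The edge from `(x, y)` to `(x, y + 1)`. -/
def vEdge (x y : ℤ) : Sym2 (ℤ × ℤ) := s((x, y), (x, y + 1))

open Classical in
/-- The indicator function of a set, with natural values. -/
noncomputable def ind {α : Type*} (E : Set α) (e : α) : ℕ := if e ∈ E then 1 else 0

theorem ind_of_mem {α : Type*} {E : Set α} {e : α} (h : e ∈ E) : ind E e = 1 := if_pos h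

theorem ind_of_notMem {α : Type*} {E : Set α} {e : α} (h : e ∉ E) : ind E e = 0 := if_neg h

theorem ind_le_one {α : Type*} (E : Set α) (e : α) : ind E e ≤ 1 := by
  unfold ind; split <;> omega

theorem ind_congr {α β : Type*} {E : Set α} {F : Set β} {e : α} {f : β} (h : e ∈ E ↔ f ∈ F) :
    ind E e = ind F f := by
  by_cases he : e ∈ E
  · rw [ind_of_mem he, ind_of_mem (h.1 he)]
  · rw [ind_of_notMem he, ind_of_notMem (he ∘ h.2)]

theorem ncard_inter_four {α : Type*} {a b c d : α} (hab : a ≠ b) (hac : a ≠ c) (had : a ≠ d)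
    (hbc : b ≠ c) (hbd : b ≠ d) (hcd : c ≠ d) (T : Set α) :
    (({a, b, c, d} : Set α) ∩ T).ncard = ind T a + ind T b + ind T c + ind T d := by
  classical
  have h : (({a, b, c, d} : Set α) ∩ T) =
      ((({a, b, c, d} : Finset α).filter (· ∈ T) : Finset α) : Set α) := by
    ext; simp
  rw [h, Set.ncard_coe_finset, Finset.card_filter, Finset.sum_insert (by simp [*]),
    Finset.sum_insert (by simp [*]), Finset.sum_insert (by simp [*]), Finset.sum_singleton]
  simp only [ind]
  ring

/-- The number of edges of the cell `(x, y)` which belong to `E`. -/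
noncomputable def cellSum (E : Set (Sym2 (ℤ × ℤ))) (x y : ℤ) : ℕ :=
  ind E (hEdge x y) + ind E (hEdge x (y + 1)) + ind E (vEdge x y) + ind E (vEdge (x + 1) y)

theorem ncard_cellEdges_inter (c : ℤ × ℤ) (E : Set (Sym2 (ℤ × ℤ))) :
    (cellEdges c ∩ E).ncard = cellSum E c.1 c.2 := by
  obtain ⟨x, y⟩ := c
  exact ncard_inter_four (by simp) (by simp) (by simp) (by simp) (by simp) (by simp) E

theorem signature_eq_iff {m n : ℕ} {C₁ C₂ : lattice.Subgraph} :
    signature m n C₁ = signature m n C₂ ↔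
      ∀ x y : ℤ, 1 ≤ x → x + 1 ≤ m → 1 ≤ y → y + 1 ≤ n →
        cellSum C₁.edgeSet x y = cellSum C₂.edgeSet x y := by
  constructor
  · intro h x y h1 h2 h3 h4
    have := congrFun h ⟨(x, y), h1, h2, h3, h4⟩
    simpa only [signature, ncard_cellEdges_inter] using this
  · intro h
    funext c
    obtain ⟨c, h1, h2, h3, h4⟩ := c
    simpa only [signature, ncard_cellEdges_inter] using h c.1 c.2 h1 h2 h3 h4

theorem lattice_adj_iff {x y : ℤ} {q : ℤ × ℤ} : lattice.Adj (x, y) q ↔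
    q = (x - 1, y) ∨ q = (x + 1, y) ∨ q = (x, y - 1) ∨ q = (x, y + 1) := by
  obtain ⟨a, b⟩ := q
  simp only [lattice, Prod.mk.injEq]
  omega

theorem exists_edge_of_adj {p q : ℤ × ℤ} (h : lattice.Adj p q) :
    ∃ x y, s(p, q) = hEdge x y ∨ s(p, q) = vEdge x y := by
  obtain ⟨x, y⟩ := p
  rcases lattice_adj_iff.1 h with rfl | rfl | rfl | rfl
  · exact ⟨x - 1, y, .inl (by rw [hEdge, Sym2.eq_swap, sub_add_cancel])⟩
  · exact ⟨x, y, .inl rfl⟩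
  · exact ⟨x, y - 1, .inr (by rw [vEdge, Sym2.eq_swap, sub_add_cancel])⟩
  · exact ⟨x, y, .inr rfl⟩

theorem edgeSet_ext {C₁ C₂ : lattice.Subgraph}
    (hh : ∀ x y, hEdge x y ∈ C₁.edgeSet ↔ hEdge x y ∈ C₂.edgeSet)
    (hv : ∀ x y, vEdge x y ∈ C₁.edgeSet ↔ vEdge x y ∈ C₂.edgeSet) :
    C₁.edgeSet = C₂.edgeSet := by
  ext e
  induction e using Sym2.ind with
  | _ p q =>
    by_cases h : lattice.Adj p q
    · obtain ⟨x, y, h | h⟩ := exists_edge_of_adj h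
      · rw [h]; exact hh x y
      · rw [h]; exact hv x y
    · exact ⟨fun h' => (h (C₁.adj_sub h')).elim, fun h' => (h (C₂.adj_sub h')).elim⟩

namespace IsGridCycle

variable {m n : ℕ} {C : lattice.Subgraph}

theorem box (h : IsGridCycle m n C) {p : ℤ × ℤ} (hp : p ∈ C.verts) :
    1 ≤ p.1 ∧ p.1 ≤ m ∧ 1 ≤ p.2 ∧ p.2 ≤ n := h.1.1 hp

theorem ncard_neighborSet (h : IsGridCycle m n C) {p : ℤ × ℤ} (hp : p ∈ C.verts) :
    (C.neighborSet p).ncard = 2 := by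
  obtain ⟨-, v, w, hw, rfl⟩ := h
  exact hw.ncard_neighborSet_toSubgraph_eq_two (by simpa using hp)

theorem exists_adj (h : IsGridCycle m n C) {p : ℤ × ℤ} (hp : p ∈ C.verts) :
    ∃ q, C.Adj p q :=
  Set.nonempty_of_ncard_ne_zero (s := C.neighborSet p) (by rw [h.ncard_neighborSet hp]; decide)

/-- A cycle has no isolated vertices, so its vertices can be read off from its edges. -/
theorem eq_of_edgeSet_eq {C' : lattice.Subgraph} (h : IsGridCycle m n C)
    (h' : IsGridCycle m n C') (he : C.edgeSet = C'.edgeSet) : C = C' := by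
  have hadj : ∀ p q, C.Adj p q ↔ C'.Adj p q := fun p q => by
    rw [← SimpleGraph.Subgraph.mem_edgeSet, he, SimpleGraph.Subgraph.mem_edgeSet]
  ext p q
  · exact ⟨fun hp => (h.exists_adj hp).elim fun q hq => C'.edge_vert ((hadj p q).1 hq),
      fun hp => (h'.exists_adj hp).elim fun q hq => C.edge_vert ((hadj p q).2 hq)⟩
  · exact hadj p q

/-- The number of edges of `C` at the point `(x, y)`. -/
theorem degree (h : IsGridCycle m n C) (x y : ℤ) :
    ind C.edgeSet (hEdge (x - 1) y) + ind C.edgeSet (hEdge x y) + ind C.edgeSet (vEdge x (y - 1)) +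
      ind C.edgeSet (vEdge x y) = 2 * ind C.verts (x, y) := by
  have hs : C.neighborSet (x, y) =
      ({(x - 1, y), (x + 1, y), (x, y - 1), (x, y + 1)} : Set (ℤ × ℤ)) ∩ C.neighborSet (x, y) := by
    refine (Set.inter_eq_right.2 fun q hq => ?_).symm
    simpa using lattice_adj_iff.1 (C.adj_sub hq)
  have e1 : ind C.edgeSet (hEdge (x - 1) y) = ind (C.neighborSet (x, y)) (x - 1, y) := by
    refine ind_congr ?_
    rw [hEdge, Sym2.eq_swap, sub_add_cancel]; rfl
  have e2 : ind C.edgeSet (hEdge x y) = ind (C.neighborSet (x, y)) (x + 1, y) := ind_congr Iff.rfl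
  have e3 : ind C.edgeSet (vEdge x (y - 1)) = ind (C.neighborSet (x, y)) (x, y - 1) := by
    refine ind_congr ?_
    rw [vEdge, Sym2.eq_swap, sub_add_cancel]; rfl
  have e4 : ind C.edgeSet (vEdge x y) = ind (C.neighborSet (x, y)) (x, y + 1) := ind_congr Iff.rfl
  rw [e1, e2, e3, e4, ← ncard_inter_four (by simp; omega) (by simp) (by simp) (by simp) (by simp)
    (by simp; omega), ← hs]
  by_cases hv : (x, y) ∈ C.verts
  · rw [h.ncard_neighborSet hv, ind_of_mem hv]
  · rw [ind_of_notMem hv, show C.neighborSet (x, y) = ∅ from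
      Set.eq_empty_of_forall_notMem fun q hq => hv (C.edge_vert hq)]
    simp

/-- Connectedness of the cycle, in the form in which it is used to show that a single orbit exhausts
the vertices. -/
theorem verts_subset (h : IsGridCycle m n C) {S : Set (ℤ × ℤ)} {p : ℤ × ℤ} (hp : p ∈ C.verts)
    (hpS : p ∈ S) (hS : ∀ a b, a ∈ S → C.Adj a b → b ∈ S) : C.verts ⊆ S := by
  intro q hq
  have hc : C.Connected := by
    obtain ⟨-, v, w, hw, rfl⟩ := h
    exact w.toSubgraph_connected
  have hr := hc.preconnected.coe ⟨p, hp⟩ ⟨q, hq⟩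
  rw [SimpleGraph.reachable_iff_reflTransGen] at hr
  have : ∀ z : C.verts, Relation.ReflTransGen C.coe.Adj ⟨p, hp⟩ z → z.1 ∈ S := by
    intro z hz
    induction hz with
    | refl => exact hpS
    | tail _ hbc ih => exact hS _ _ ih hbc
  exact this _ hr

theorem verts_nonempty (h : IsGridCycle m n C) : C.verts.Nonempty := by
  obtain ⟨-, v, w, hw, rfl⟩ := h
  exact ⟨v, by simp⟩

end IsGridCycle

end Slitherlink

/-! ### The interior of a cycle modulo 2 -/

namespace Slitherlink

/-- `g` is the indicator function of the set of cells which `C` encloses. -/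
structure IsInterior (m n : ℕ) (C : lattice.Subgraph) (g : ℤ → ℤ → ZMod 2) : Prop where
  vert : ∀ x y, g (x - 1) y + g x y = ind C.edgeSet (vEdge x y)
  horiz : ∀ x y, g x (y - 1) + g x y = ind C.edgeSet (hEdge x y)
  outside : ∀ x y : ℤ, ¬(1 ≤ x ∧ x + 1 ≤ m ∧ 1 ≤ y ∧ y + 1 ≤ n) → g x y = 0

theorem two_eq_zero_zmod : (2 : ZMod 2) = 0 := by decide

namespace IsGridCycle

variable {m n : ℕ} {C : lattice.Subgraph}

theorem hEdge_box (h : IsGridCycle m n C) {x y : ℤ} (he : hEdge x y ∈ C.edgeSet) :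
    1 ≤ x ∧ x + 1 ≤ m ∧ 1 ≤ y ∧ y ≤ n := by
  have h1 := h.box (C.edge_vert he)
  have h2 := h.box (C.edge_vert (C.adj_symm he))
  dsimp only at h1 h2
  omega

theorem vEdge_box (h : IsGridCycle m n C) {x y : ℤ} (he : vEdge x y ∈ C.edgeSet) :
    1 ≤ x ∧ x ≤ m ∧ 1 ≤ y ∧ y + 1 ≤ n := by
  have h1 := h.box (C.edge_vert he)
  have h2 := h.box (C.edge_vert (C.adj_symm he))
  dsimp only at h1 h2
  omega

/-- The parity of the number of vertical edges crossed by the rightward ray from a cell. Only the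
evenness of the degrees and the bounding box enter; no Jordan curve theorem is needed. -/
theorem exists_isInterior (h : IsGridCycle m n C) : ∃ g, IsInterior m n C g := by
  set v : ℤ → ℤ → ZMod 2 := fun x y => ind C.edgeSet (vEdge x y) with hv
  set w : ℤ → ℤ → ZMod 2 := fun x y => ind C.edgeSet (hEdge x y) with hw
  have v0 : ∀ x y : ℤ, ¬(1 ≤ x ∧ x ≤ m ∧ 1 ≤ y ∧ y + 1 ≤ n) → v x y = 0 := fun x y hxy => by
    simp only [hv, ind_of_notMem fun he => hxy (h.vEdge_box he), Nat.cast_zero]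
  have w0 : ∀ x y : ℤ, ¬(1 ≤ x ∧ x + 1 ≤ m ∧ 1 ≤ y ∧ y ≤ n) → w x y = 0 := fun x y hxy => by
    simp only [hw, ind_of_notMem fun he => hxy (h.hEdge_box he), Nat.cast_zero]
  have hdeg : ∀ x y, w (x - 1) y + w x y + v x (y - 1) + v x y = 0 := fun x y => by
    have := congrArg (Nat.cast : ℕ → ZMod 2) (h.degree x y)
    push_cast at this
    rw [two_eq_zero_zmod, zero_mul] at this
    exact this
  set g : ℤ → ℤ → ZMod 2 := fun x y => ∑ t ∈ Finset.Ioc x m, v t y with hg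
  have gbig : ∀ x y : ℤ, (m : ℤ) ≤ x → g x y = 0 := fun x y hx => by
    simp only [hg, Finset.Ioc_eq_empty_of_le hx, Finset.sum_empty]
  have gv : ∀ x y, g (x - 1) y = v x y + g x y := fun x y => by
    rcases le_or_gt x m with hx | hx
    · have : Finset.Ioc (x - 1) (m : ℤ) = insert x (Finset.Ioc x m) := by
        ext t; simp only [Finset.mem_Ioc, Finset.mem_insert]; omega
      simp only [hg, this]
      rw [Finset.sum_insert (by simp)]
    · rw [gbig _ _ (by omega), gbig _ _ (by omega), v0 _ _ (by omega), add_zero]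
  have gw : ∀ x y, g x (y - 1) + g x y = w x y := by
    -- Induction leftwards from the right border; passing a vertex changes both sides by the same
    -- amount because its degree is even.
    have key : ∀ k : ℕ, ∀ y, g (m - k) (y - 1) + g (m - k) y = w (m - k) y := by
      intro k
      induction k with
      | zero =>
        intro y
        rw [gbig _ _ (by simp), gbig _ _ (by simp), w0 _ _ (by simp), add_zero]
      | succ k ih =>
        intro y
        have e : (m : ℤ) - (k + 1 : ℕ) = m - k - 1 := by push_cast; ring
        rw [e, gv, gv]
        linear_combination ih y - hdeg (m - k) y + w (m - k) y * two_eq_zero_zmod +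
          (v (m - k) (y - 1) + v (m - k) y) * two_eq_zero_zmod
    intro x y
    rcases le_or_gt x m with hx | hx
    · have := key (m - x).toNat y
      rwa [show (m : ℤ) - ((m - x).toNat : ℕ) = x by omega] at this
    · rw [gbig _ _ (by omega), gbig _ _ (by omega), w0 _ _ (by omega), add_zero]
  refine ⟨g, fun x y => ?_, gw, fun x y hxy => ?_⟩
  · rw [gv]
    linear_combination g x y * two_eq_zero_zmod
  · have gy : ∀ x y : ℤ, ¬(1 ≤ y ∧ y + 1 ≤ n) → g x y = 0 := fun x y hy =>
      Finset.sum_eq_zero fun t _ => v0 t y (by omega)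
    by_cases hy : 1 ≤ y ∧ y + 1 ≤ n
    · rcases le_or_gt (m : ℤ) x with hx | hx
      · exact gbig _ _ hx
      · have hx0 : x < 1 := by omega
        -- Left of the grid there are no horizontal edges, so `g x` does not change from row to row,
        -- and it vanishes in row 0.
        have key : ∀ k : ℕ, g x k = 0 := by
          intro k
          induction k with
          | zero => exact gy _ _ (by simp)
          | succ k ih =>
            have := gw x (k + 1)
            rw [add_sub_cancel_right, ih, zero_add, w0 _ _ (by omega)] at this
            exact_mod_cast this
        have := key y.toNat
        rwa [Int.toNat_of_nonneg (by omega)] at this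
    · exact gy _ _ hy

end IsGridCycle

/-! ### The discrete wave equation modulo 2 and its reflections -/

/-- The distance from `x` to the nearest multiple of `2 * m`. -/
def fold (m : ℕ) (x : ℤ) : ℤ := min (x % (2 * m)) (2 * m - x % (2 * m))

theorem fold_eq {m : ℕ} (hm : 0 < m) (k r : ℤ) (h0 : 0 ≤ r) (h1 : r ≤ 2 * m) :
    fold m (r + 2 * m * k) = min r (2 * m - r) := by
  rcases h1.lt_or_eq with h1 | h1
  · rw [fold, Int.add_mul_emod_self_left, Int.emod_eq_of_lt h0 h1]
  · subst h1
    rw [fold, Int.add_mul_emod_self_left, Int.emod_self]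
    omega

theorem exists_fold {m : ℕ} (hm : 0 < m) (x : ℤ) :
    ∃ k r : ℤ, 0 ≤ r ∧ r < 2 * m ∧ x = r + 2 * m * k :=
  ⟨x / (2 * m), x % (2 * m), Int.emod_nonneg _ (by omega), Int.emod_lt_of_pos _ (by omega),
    (Int.emod_add_mul_ediv _ _).symm⟩

theorem fold_neg {m : ℕ} (hm : 0 < m) (x : ℤ) : fold m (-x) = fold m x := by
  obtain ⟨k, r, h0, h1, rfl⟩ := exists_fold hm x
  rw [fold_eq hm _ _ h0 h1.le, show -(r + 2 * m * k) = (2 * m - r) + 2 * m * (-k - 1) by ring,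
    fold_eq hm _ _ (by omega) (by omega)]
  omega

theorem fold_add_period (m : ℕ) (x : ℤ) : fold m (x + 2 * m) = fold m x := by
  rw [fold, fold, Int.add_emod_right]

theorem fold_of_mem {m : ℕ} (hm : 0 < m) {x : ℤ} (h0 : 0 ≤ x) (h1 : x ≤ m) : fold m x = x := by
  have := fold_eq hm 0 x h0 (by omega)
  rw [mul_zero, add_zero] at this
  omega

/-- `fold m` is a zigzag between `0` and `m`: at a turning point both neighbours have the same
image, and elsewhere the neighbours map to the two neighbours in some order. -/
theorem fold_step {m : ℕ} (hm : 0 < m) (x : ℤ) :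
    ((fold m x = 0 ∨ fold m x = m) ∧ fold m (x - 1) = fold m (x + 1)) ∨
    (1 ≤ fold m x ∧ fold m x + 1 ≤ m ∧
      ((fold m (x - 1) = fold m x - 1 ∧ fold m (x + 1) = fold m x + 1) ∨
       (fold m (x - 1) = fold m x + 1 ∧ fold m (x + 1) = fold m x - 1))) := by
  obtain ⟨k, r, h0, h1, rfl⟩ := exists_fold hm x
  rw [fold_eq hm _ _ h0 h1.le, show r + 2 * m * k + 1 = (r + 1) + 2 * m * k by ring,
    fold_eq hm k (r + 1) (by omega) (by omega)]
  rcases h0.lt_or_eq with h0 | h0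
  · rw [show r + 2 * m * k - 1 = (r - 1) + 2 * m * k by ring,
      fold_eq hm k (r - 1) (by omega) (by omega)]
    omega
  · subst h0
    rw [show 0 + 2 * m * k - 1 = (2 * m - 1) + 2 * m * (k - 1) by ring,
      fold_eq hm _ (2 * m - 1) (by omega) (by omega)]
    omega

section Wave

variable {F : ℤ → ℤ → ZMod 2}

/-- The wave equation is the smallest case, a tilted unit square. A larger tilted rectangle is a
union of these, and the values at shared corners cancel modulo 2. -/
theorem wave_rectangle (hF : ∀ x y, F (x - 1) y + F (x + 1) y + F x (y - 1) + F x (y + 1) = 0)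
    (i j : ℕ) (x y : ℤ) :
    F x y + F (x + i) (y + i) + F (x + j) (y - j) + F (x + i + j) (y + i - j) = 0 := by
  have h1 : ∀ (i : ℕ) (x y : ℤ),
      F x y + F (x + i) (y + i) + F (x + 1) (y - 1) + F (x + i + 1) (y + i - 1) = 0 := by
    intro i
    induction i with
    | zero =>
      intro x y
      simp only [Nat.cast_zero, add_zero]
      linear_combination (F x y + F (x + 1) (y - 1)) * two_eq_zero_zmod
    | succ i ih =>
      intro x y
      have a := ih x y
      have b := hF (x + i + 1) (y + i)
      rw [show x + i + 1 - 1 = x + i by ring] at b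
      push_cast
      rw [show x + (i + 1 : ℤ) = x + i + 1 by ring, show y + (i + 1 : ℤ) = y + i + 1 by ring,
        show y + i + 1 - 1 = y + i by ring]
      linear_combination a + b - (F (x + i) (y + i) + F (x + i + 1) (y + i - 1)) * two_eq_zero_zmod
  induction j generalizing x y with
  | zero =>
    simp only [Nat.cast_zero, add_zero, sub_zero]
    linear_combination (F x y + F (x + i) (y + i)) * two_eq_zero_zmod
  | succ j ih =>
    have a := ih x y
    have b := h1 i (x + j) (y - j)
    rw [show x + j + i = x + i + j by ring, show y - j + i = y + i - j by ring] at b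
    push_cast
    rw [show x + (j + 1 : ℤ) = x + j + 1 by ring, show y - (j + 1 : ℤ) = y - j - 1 by ring,
      show x + i + (j + 1 : ℤ) = x + i + j + 1 by ring,
      show y + i - (j + 1 : ℤ) = y + i - j - 1 by ring]
    linear_combination a + b - (F (x + j) (y - j) + F (x + i + j) (y + i - j)) * two_eq_zero_zmod

theorem wave_symm (hF : ∀ x y, F (x - 1) y + F (x + 1) y + F x (y - 1) + F x (y + 1) = 0)
    (hx : ∀ x y, F (-x) y = F x y) (hy : ∀ x y, F x (-y) = F x y)
    (h0x : ∀ y, F 0 y = 0) (h0y : ∀ x, F x 0 = 0) (x y : ℤ) : F x y = F y x := by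
  have key : ∀ i j : ℕ, F j i = F i j := by
    intro i j
    -- The corners of this rectangle are `(-i, j)`, `(0, i + j)`, `(j - i, 0)` and `(j, i)`; the two
    -- on the axes contribute zero and evenness turns the first into `(i, j)`.
    have := wave_rectangle hF i j (-i) j
    rw [neg_add_cancel, h0x, sub_self, h0y, hx, zero_add, show (j : ℤ) + i - j = i by ring] at this
    linear_combination this - F i j * two_eq_zero_zmod
  have hax : ∀ x y, F |x| y = F x y := fun x y => by
    rcases abs_choice x with h | h <;> rw [h]
    exact hx x y
  have hay : ∀ x y, F x |y| = F x y := fun x y => by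
    rcases abs_choice y with h | h <;> rw [h]
    exact hy x y
  have := key y.natAbs x.natAbs
  rwa [Int.natCast_natAbs, Int.natCast_natAbs, hax, hay, hax, hay] at this

end Wave

/-- A function on the cells of the grid whose sum over the neighbours of each cell vanishes extends
to a function on the plane with the periodicity and symmetry of a billiard trajectory. -/
theorem exists_wave_extension {m n : ℕ} (hm : 0 < m) (hn : 0 < n) {g : ℤ → ℤ → ZMod 2}
    (hout : ∀ x y : ℤ, ¬(1 ≤ x ∧ x + 1 ≤ m ∧ 1 ≤ y ∧ y + 1 ≤ n) → g x y = 0)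
    (hw : ∀ x y : ℤ, 1 ≤ x → x + 1 ≤ m → 1 ≤ y → y + 1 ≤ n →
      g (x - 1) y + g (x + 1) y + g x (y - 1) + g x (y + 1) = 0) :
    ∃ F : ℤ → ℤ → ZMod 2, (∀ x y : ℤ, 0 ≤ x → x ≤ m → 0 ≤ y → y ≤ n → F x y = g x y) ∧
      (∀ x y, F x y = F y x) ∧ (∀ x y, F (-x) y = F x y) ∧ (∀ y, F 0 y = 0) ∧
      (∀ y, F m y = 0) ∧ (∀ y, F n y = 0) ∧
      ∀ x y, F (x + 2 * (Nat.gcd m n : ℕ)) y = F x y := by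
  set F : ℤ → ℤ → ZMod 2 := fun x y => g (fold m x) (fold n y) with hFdef
  have hF : ∀ x y, F (x - 1) y + F (x + 1) y + F x (y - 1) + F x (y + 1) = 0 := by
    intro x y
    simp only [hFdef]
    -- At a turning point the folded coordinate lies on the border, where `g` vanishes, and the
    -- other two terms are equal and cancel modulo 2.
    rcases fold_step hm x with ⟨hx, hx'⟩ | ⟨h1, h2, hx⟩
    · rw [hx', hout _ (fold n (y - 1)) (by omega), hout _ (fold n (y + 1)) (by omega)]
      linear_combination g (fold m (x + 1)) (fold n y) * two_eq_zero_zmod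
    rcases fold_step hn y with ⟨hy, hy'⟩ | ⟨h3, h4, hy⟩
    · rw [hy', hout (fold m (x - 1)) _ (by omega), hout (fold m (x + 1)) _ (by omega)]
      linear_combination g (fold m x) (fold n (y + 1)) * two_eq_zero_zmod
    have := hw _ _ h1 h2 h3 h4
    rcases hx with ⟨a, b⟩ | ⟨a, b⟩ <;> rcases hy with ⟨c, d⟩ | ⟨c, d⟩ <;> rw [a, b, c, d] <;>
      linear_combination this
  have hx : ∀ x y, F (-x) y = F x y := fun x y => by simp only [hFdef, fold_neg hm]
  have hy : ∀ x y, F x (-y) = F x y := fun x y => by simp only [hFdef, fold_neg hn]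
  have h0x : ∀ y, F 0 y = 0 := fun y => hout _ _ (by
    rw [fold_of_mem hm le_rfl (by omega)]; omega)
  have h0y : ∀ x, F x 0 = 0 := fun x => hout _ _ (by
    rw [fold_of_mem hn le_rfl (by omega)]; omega)
  have hsymm := wave_symm hF hx hy h0x h0y
  have hmz : ∀ y, F m y = 0 := fun y => hout _ _ (by
    rw [fold_of_mem hm (by omega) le_rfl]; omega)
  have hnz : ∀ y, F n y = 0 := fun y => by
    rw [hsymm]
    exact hout _ _ (by rw [fold_of_mem hn (by omega) le_rfl]; omega)
  refine ⟨F, fun x y h0 h1 h2 h3 => ?_, hsymm, hx, h0x, hmz, hnz, fun x y => ?_⟩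
  · simp only [hFdef, fold_of_mem hm h0 h1, fold_of_mem hn h2 h3]
  · have pm : Function.Periodic (fun x => F x y) (2 * m) := fun x => by
      simp only [hFdef, fold_add_period m]
    have pn : Function.Periodic (fun x => F x y) (2 * n) := fun x => by
      simp only [hsymm _ y]
      simp only [hFdef, fold_add_period n]
    -- By symmetry the period `2 * n` in the second coordinate is also one in the first, so Bézout
    -- combines the two.
    have hp := (pm.int_mul (Nat.gcdA m n)).add_period (pn.int_mul (Nat.gcdB m n))
    have e : (2 * (Nat.gcd m n : ℕ) : ℤ) =
        Nat.gcdA m n * (2 * m) + Nat.gcdB m n * (2 * n) := by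
      rw [Nat.gcd_eq_gcd_ab]; ring
    rw [e]
    exact hp x

/-- The extension has period 2 and vanishes at `x = 0`, `m` and `n`; one of `m`, `n` is odd, so both
parities of `x` are covered. -/
theorem wave_eq_zero_of_coprime {m n : ℕ} (hm : 0 < m) (hn : 0 < n) (hd : Nat.gcd m n = 1)
    {g : ℤ → ℤ → ZMod 2}
    (hout : ∀ x y : ℤ, ¬(1 ≤ x ∧ x + 1 ≤ m ∧ 1 ≤ y ∧ y + 1 ≤ n) → g x y = 0)
    (hw : ∀ x y : ℤ, 1 ≤ x → x + 1 ≤ m → 1 ≤ y → y + 1 ≤ n →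
      g (x - 1) y + g (x + 1) y + g x (y - 1) + g x (y + 1) = 0) (x y : ℤ) : g x y = 0 := by
  obtain ⟨F, hFg, -, -, h0, hmz, hnz, hp⟩ := exists_wave_extension hm hn hout hw
  rw [hd] at hp
  by_cases hxy : 1 ≤ x ∧ x + 1 ≤ m ∧ 1 ≤ y ∧ y + 1 ≤ n
  swap
  · exact hout _ _ hxy
  rw [← hFg x y (by omega) (by omega) (by omega) (by omega)]
  have p : Function.Periodic (fun x => F x y) 2 := fun x => hp x y
  have hmod : ∀ a b : ℤ, a % 2 = b % 2 → F a y = F b y := by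
    intro a b hab
    have := p.int_mul ((b - a) / 2) a
    rw [Int.cast_id, show a + (b - a) / 2 * 2 = b by omega] at this
    exact this.symm
  rcases Int.emod_two_eq_zero_or_one x with h | h
  · rw [hmod x 0 (by omega), h0]
  · have : m % 2 = 1 ∨ n % 2 = 1 := by
      by_contra hcon
      have := Nat.dvd_gcd (Nat.dvd_of_mod_eq_zero (show m % 2 = 0 by omega))
        (Nat.dvd_of_mod_eq_zero (show n % 2 = 0 by omega))
      rw [hd] at this
      exact absurd this (by decide)
    rcases this with h' | h'
    · rw [hmod x m (by omega), hmz]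
    · rw [hmod x n (by omega), hnz]

/-- The extension has period 4. It vanishes for even `x`, since one of `m`, `n` is `2` modulo 4, and
evenness in `x` identifies the residues 1 and 3. Symmetry carries this over to `y`. -/
theorem wave_of_gcd_eq_two {m n : ℕ} (hm : 0 < m) (hn : 0 < n) (hd : Nat.gcd m n = 2)
    {g : ℤ → ℤ → ZMod 2}
    (hout : ∀ x y : ℤ, ¬(1 ≤ x ∧ x + 1 ≤ m ∧ 1 ≤ y ∧ y + 1 ≤ n) → g x y = 0)
    (hw : ∀ x y : ℤ, 1 ≤ x → x + 1 ≤ m → 1 ≤ y → y + 1 ≤ n →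
      g (x - 1) y + g (x + 1) y + g x (y - 1) + g x (y + 1) = 0) (x y : ℤ)
    (hx : 0 ≤ x) (hx' : x ≤ m) (hy : 0 ≤ y) (hy' : y ≤ n) :
    g x y = if x % 2 = 1 ∧ y % 2 = 1 then g 1 1 else 0 := by
  obtain ⟨F, hFg, hsymm, hneg, h0, hmz, hnz, hp⟩ := exists_wave_extension hm hn hout hw
  rw [hd] at hp
  have hmod : ∀ y a b : ℤ, a % 4 = b % 4 → F a y = F b y := by
    intro y a b hab
    have p : Function.Periodic (fun x => F x y) 4 := fun x => hp x y
    have := p.int_mul ((b - a) / 4) a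
    rw [Int.cast_id, show a + (b - a) / 4 * 4 = b by omega] at this
    exact this.symm
  have h2 : ∀ y, F 2 y = 0 := by
    intro y
    have e1 : m % 2 = 0 := Nat.mod_eq_zero_of_dvd (hd ▸ Nat.gcd_dvd_left m n)
    have e2 : n % 2 = 0 := Nat.mod_eq_zero_of_dvd (hd ▸ Nat.gcd_dvd_right m n)
    have : m % 4 = 2 ∨ n % 4 = 2 := by
      by_contra hcon
      have := Nat.dvd_gcd (Nat.dvd_of_mod_eq_zero (show m % 4 = 0 by omega))
        (Nat.dvd_of_mod_eq_zero (show n % 4 = 0 by omega))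
      rw [hd] at this
      exact absurd this (by decide)
    rcases this with h' | h'
    · rw [hmod y 2 m (by omega), hmz]
    · rw [hmod y 2 n (by omega), hnz]
  have heven : ∀ x y, x % 2 = 0 → F x y = 0 := by
    intro x y h
    rcases (by omega : x % 4 = 0 ∨ x % 4 = 2) with h | h
    · rw [hmod y x 0 (by omega), h0]
    · rw [hmod y x 2 (by omega), h2]
  have hodd : ∀ x y, x % 2 = 1 → F x y = F 1 y := by
    intro x y h
    rcases (by omega : x % 4 = 1 ∨ x % 4 = 3) with h | h
    · exact hmod y x 1 (by omega)
    · rw [← hneg 1]; exact hmod y x (-1) (by omega)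
  rw [← hFg x y hx hx' hy hy', ← hFg 1 1 (by omega) (by omega) (by omega) (by omega)]
  split_ifs with h
  · rw [hodd x y h.1, hsymm, hodd y 1 h.2]
  · rcases Int.emod_two_eq_zero_or_one x with h' | h'
    · exact heven _ _ h'
    · rw [hsymm]; exact heven _ _ (by omega)

end Slitherlink

/-! ### Cycles as permutations: following the boundary with the interior on the left -/

namespace Slitherlink

open Equiv

/-- The step which a cycle takes at a vertex when it keeps its interior to the left, in terms of
which of the four cells around the vertex are enclosed. -/
def dirOut (ne nw sw se : Bool) : ℤ × ℤ :=
  if ne && !se then (1, 0) else if nw && !ne then (0, 1) else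
    if sw && !nw then (-1, 0) else if se && !sw then (0, -1) else (0, 0)

/-- The step back to the previous vertex of a cycle which keeps its interior to the left. -/
def dirIn (ne nw sw se : Bool) : ℤ × ℤ :=
  if se && !ne then (1, 0) else if ne && !nw then (0, 1) else
    if nw && !sw then (-1, 0) else if sw && !se then (0, -1) else (0, 0)

/-- The four cells around a vertex do not form a checkerboard. -/
def NoCross (ne nw sw se : Bool) : Prop := ¬(ne = sw ∧ nw = se ∧ ne ≠ nw)

instance (ne nw sw se : Bool) : Decidable (NoCross ne nw sw se) := by
  unfold NoCross; infer_instance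

theorem dirOut_cases : ∀ ne nw sw se : Bool,
    (ne = true ∧ se = false ∧ dirOut ne nw sw se = (1, 0)) ∨
    (nw = true ∧ ne = false ∧ dirOut ne nw sw se = (0, 1)) ∨
    (sw = true ∧ nw = false ∧ dirOut ne nw sw se = (-1, 0)) ∨
    (se = true ∧ sw = false ∧ dirOut ne nw sw se = (0, -1)) ∨ dirOut ne nw sw se = (0, 0) ∧
      dirIn ne nw sw se = (0, 0) := by decide

theorem dirIn_cases : ∀ ne nw sw se : Bool,
    (se = true ∧ ne = false ∧ dirIn ne nw sw se = (1, 0)) ∨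
    (ne = true ∧ nw = false ∧ dirIn ne nw sw se = (0, 1)) ∨
    (nw = true ∧ sw = false ∧ dirIn ne nw sw se = (-1, 0)) ∨
    (sw = true ∧ se = false ∧ dirIn ne nw sw se = (0, -1)) ∨ dirIn ne nw sw se = (0, 0) ∧
      dirOut ne nw sw se = (0, 0) := by decide

/-- Without a checkerboard at most one branch of the definition applies, so the order of its tests
is immaterial. -/
theorem dirOut_eq : ∀ ne nw sw se : Bool, NoCross ne nw sw se →
    (ne = true → se = false → dirOut ne nw sw se = (1, 0)) ∧
    (nw = true → ne = false → dirOut ne nw sw se = (0, 1)) ∧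
    (sw = true → nw = false → dirOut ne nw sw se = (-1, 0)) ∧
    (se = true → sw = false → dirOut ne nw sw se = (0, -1)) := by decide

theorem dirIn_eq : ∀ ne nw sw se : Bool, NoCross ne nw sw se →
    (se = true → ne = false → dirIn ne nw sw se = (1, 0)) ∧
    (ne = true → nw = false → dirIn ne nw sw se = (0, 1)) ∧
    (nw = true → sw = false → dirIn ne nw sw se = (-1, 0)) ∧
    (sw = true → se = false → dirIn ne nw sw se = (0, -1)) := by decide

/-- The successor of a vertex on the boundary of the set of cells `β`, with `β` to the left. -/
def nxt (β : ℤ → ℤ → Bool) (p : ℤ × ℤ) : ℤ × ℤ :=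
  p + dirOut (β p.1 p.2) (β (p.1 - 1) p.2) (β (p.1 - 1) (p.2 - 1)) (β p.1 (p.2 - 1))

/-- The predecessor of a vertex on the boundary of the set of cells `β`, with `β` to the left. -/
def prv (β : ℤ → ℤ → Bool) (p : ℤ × ℤ) : ℤ × ℤ :=
  p + dirIn (β p.1 p.2) (β (p.1 - 1) p.2) (β (p.1 - 1) (p.2 - 1)) (β p.1 (p.2 - 1))

theorem prv_nxt {β : ℤ → ℤ → Bool}
    (hβ : ∀ x y, NoCross (β x y) (β (x - 1) y) (β (x - 1) (y - 1)) (β x (y - 1))) (p : ℤ × ℤ) :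
    prv β (nxt β p) = p := by
  obtain ⟨x, y⟩ := p
  rcases dirOut_cases (β x y) (β (x - 1) y) (β (x - 1) (y - 1)) (β x (y - 1)) with
    ⟨h1, h2, h⟩ | ⟨h1, h2, h⟩ | ⟨h1, h2, h⟩ | ⟨h1, h2, h⟩ | ⟨h, h'⟩
  · have e : nxt β (x, y) = (x + 1, y) := by simp [nxt, h]
    rw [e]
    have := (dirIn_eq _ _ _ _ (hβ (x + 1) y)).2.2.1
    simp only [add_sub_cancel_right] at this
    simp [prv, this h1 h2]
  · have e : nxt β (x, y) = (x, y + 1) := by simp [nxt, h]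
    rw [e]
    have := (dirIn_eq _ _ _ _ (hβ x (y + 1))).2.2.2
    simp only [add_sub_cancel_right] at this
    simp [prv, this h1 h2]
  · have e : nxt β (x, y) = (x - 1, y) := by simp [nxt, h, ← sub_eq_add_neg]
    rw [e]
    have := (dirIn_eq _ _ _ _ (hβ (x - 1) y)).1 h1 h2
    simp [prv, this]
  · have e : nxt β (x, y) = (x, y - 1) := by simp [nxt, h, ← sub_eq_add_neg]
    rw [e]
    have := (dirIn_eq _ _ _ _ (hβ x (y - 1))).2.1 h1 h2
    simp [prv, this]
  · simp [nxt, h, prv, h']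

theorem nxt_prv {β : ℤ → ℤ → Bool}
    (hβ : ∀ x y, NoCross (β x y) (β (x - 1) y) (β (x - 1) (y - 1)) (β x (y - 1))) (p : ℤ × ℤ) :
    nxt β (prv β p) = p := by
  obtain ⟨x, y⟩ := p
  rcases dirIn_cases (β x y) (β (x - 1) y) (β (x - 1) (y - 1)) (β x (y - 1)) with
    ⟨h1, h2, h⟩ | ⟨h1, h2, h⟩ | ⟨h1, h2, h⟩ | ⟨h1, h2, h⟩ | ⟨h, h'⟩
  · have e : prv β (x, y) = (x + 1, y) := by simp [prv, h]
    rw [e]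
    have := (dirOut_eq _ _ _ _ (hβ (x + 1) y)).2.2.1
    simp only [add_sub_cancel_right] at this
    simp [nxt, this h1 h2]
  · have e : prv β (x, y) = (x, y + 1) := by simp [prv, h]
    rw [e]
    have := (dirOut_eq _ _ _ _ (hβ x (y + 1))).2.2.2
    simp only [add_sub_cancel_right] at this
    simp [nxt, this h1 h2]
  · have e : prv β (x, y) = (x - 1, y) := by simp [prv, h, ← sub_eq_add_neg]
    rw [e]
    have := (dirOut_eq _ _ _ _ (hβ (x - 1) y)).1 h1 h2
    simp [nxt, this]
  · have e : prv β (x, y) = (x, y - 1) := by simp [prv, h, ← sub_eq_add_neg]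
    rw [e]
    have := (dirOut_eq _ _ _ _ (hβ x (y - 1))).2.1 h1 h2
    simp [nxt, this]
  · simp [nxt, h, prv, h']

/-- The permutation of the lattice points which moves each vertex on the boundary of `β` to the
next one. -/
def nxtPerm (β : ℤ → ℤ → Bool)
    (hβ : ∀ x y, NoCross (β x y) (β (x - 1) y) (β (x - 1) (y - 1)) (β x (y - 1))) :
    Perm (ℤ × ℤ) :=
  ⟨nxt β, prv β, prv_nxt hβ, nxt_prv hβ⟩

/-- The boundary of the set of cells `β` is the edge set of `C`. -/
structure Encloses (β : ℤ → ℤ → Bool) (C : lattice.Subgraph) : Prop where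
  vert : ∀ x y, vEdge x y ∈ C.edgeSet ↔ β (x - 1) y ≠ β x y
  horiz : ∀ x y, hEdge x y ∈ C.edgeSet ↔ β x (y - 1) ≠ β x y

namespace Encloses

variable {m n : ℕ} {C : lattice.Subgraph} {β : ℤ → ℤ → Bool}

/-- A checkerboard would give the vertex degree four. -/
theorem noCross (h : Encloses β C) (hC : IsGridCycle m n C) (x y : ℤ) :
    NoCross (β x y) (β (x - 1) y) (β (x - 1) (y - 1)) (β x (y - 1)) := by
  rintro ⟨h1, h2, h3⟩
  have hd := hC.degree x y
  have e1 : hEdge (x - 1) y ∈ C.edgeSet := (h.horiz _ _).2 (by rw [← h1]; exact h3)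
  have e2 : hEdge x y ∈ C.edgeSet := (h.horiz _ _).2 (by rw [← h2]; exact h3.symm)
  have e3 : vEdge x (y - 1) ∈ C.edgeSet := (h.vert _ _).2 (by rw [← h1, ← h2]; exact h3)
  have e4 : vEdge x y ∈ C.edgeSet := (h.vert _ _).2 h3.symm
  rw [ind_of_mem e1, ind_of_mem e2, ind_of_mem e3, ind_of_mem e4] at hd
  have := ind_le_one C.verts (x, y)
  omega

theorem adj_nxt (h : Encloses β C) {p : ℤ × ℤ} (hp : nxt β p ≠ p) : C.Adj p (nxt β p) := by
  obtain ⟨x, y⟩ := p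
  rcases dirOut_cases (β x y) (β (x - 1) y) (β (x - 1) (y - 1)) (β x (y - 1)) with
    ⟨h1, h2, h3⟩ | ⟨h1, h2, h3⟩ | ⟨h1, h2, h3⟩ | ⟨h1, h2, h3⟩ | ⟨h3, -⟩
  · have e : nxt β (x, y) = (x + 1, y) := by simp [nxt, h3]
    rw [e]
    exact (h.horiz x y).2 (by rw [h1, h2]; decide)
  · have e : nxt β (x, y) = (x, y + 1) := by simp [nxt, h3]
    rw [e]
    exact (h.vert x y).2 (by rw [h1, h2]; decide)
  · have e : nxt β (x, y) = (x - 1, y) := by simp [nxt, h3, ← sub_eq_add_neg]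
    rw [e]
    have : C.Adj _ _ := (h.horiz (x - 1) y).2 (by rw [h1, h2]; decide)
    rw [sub_add_cancel] at this
    exact C.adj_symm this
  · have e : nxt β (x, y) = (x, y - 1) := by simp [nxt, h3, ← sub_eq_add_neg]
    rw [e]
    have : C.Adj _ _ := (h.vert x (y - 1)).2 (by rw [h1, h2]; decide)
    rw [sub_add_cancel] at this
    exact C.adj_symm this
  · exact (hp (by simp [nxt, h3])).elim

theorem nxt_eq_of_adj (h : Encloses β C) (hC : IsGridCycle m n C) {p q : ℤ × ℤ}
    (hpq : C.Adj p q) : nxt β p = q ∨ nxt β q = p := by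
  have hh : ∀ x y, hEdge x y ∈ C.edgeSet →
      nxt β (x, y) = (x + 1, y) ∨ nxt β (x + 1, y) = (x, y) := by
    intro x y he
    have := (h.horiz x y).1 he
    cases h1 : β x y
    · right
      have := (dirOut_eq _ _ _ _ (h.noCross hC (x + 1) y)).2.2.1
      simp only [add_sub_cancel_right] at this
      simp [nxt, this (by simp_all) h1]
    · left
      have := (dirOut_eq _ _ _ _ (h.noCross hC x y)).1 h1 (by simp_all)
      simp [nxt, this]
  have hv : ∀ x y, vEdge x y ∈ C.edgeSet →
      nxt β (x, y) = (x, y + 1) ∨ nxt β (x, y + 1) = (x, y) := by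
    intro x y he
    have := (h.vert x y).1 he
    cases h1 : β x y
    · left
      have := (dirOut_eq _ _ _ _ (h.noCross hC x y)).2.1 (by simp_all) h1
      simp [nxt, this]
    · right
      have := (dirOut_eq _ _ _ _ (h.noCross hC x (y + 1))).2.2.2
      simp only [add_sub_cancel_right] at this
      simp [nxt, this h1 (by simp_all)]
  obtain ⟨x, y⟩ := p
  rcases lattice_adj_iff.1 (C.adj_sub hpq) with rfl | rfl | rfl | rfl
  · have he : hEdge (x - 1) y ∈ C.edgeSet := by
      rw [hEdge, sub_add_cancel]; exact C.adj_symm hpq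
    simpa [or_comm] using hh _ _ he
  · exact hh x y hpq
  · have he : vEdge x (y - 1) ∈ C.edgeSet := by
      rw [vEdge, sub_add_cancel]; exact C.adj_symm hpq
    simpa [or_comm] using hv _ _ he
  · exact hv x y hpq

/-- Adjacent vertices of the cycle are consecutive for the permutation in one order or the other, so
an orbit is closed under adjacency and, by connectedness, contains every vertex of the cycle. -/
theorem isCycle_nxtPerm (h : Encloses β C) (hC : IsGridCycle m n C) :
    (nxtPerm β (h.noCross hC)).IsCycle := by
  set τ := nxtPerm β (h.noCross hC) with hτ
  have hτa : ∀ p, τ p = nxt β p := fun p => rfl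
  obtain ⟨p, hp⟩ := hC.verts_nonempty
  have hne : τ p ≠ p := by
    intro hfix
    obtain ⟨q, hq⟩ := hC.exists_adj hp
    rcases h.nxt_eq_of_adj hC hq with h1 | h1
    · rw [← hτa, hfix] at h1
      exact C.loopless.irrefl _ (h1 ▸ hq)
    · rw [← hτa] at h1
      have := τ.injective (h1.trans hfix.symm)
      exact C.loopless.irrefl _ (this ▸ hq)
  refine ⟨p, hne, fun q hq => ?_⟩
  refine hC.verts_subset (S := {q | τ.SameCycle p q}) hp (Perm.SameCycle.refl _ _) ?_
    (C.edge_vert (h.adj_nxt hq))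
  intro a b ha hab
  rcases h.nxt_eq_of_adj hC hab with h1 | h1
  · rw [← hτa] at h1
    rw [← h1]
    exact Perm.sameCycle_apply_right.2 ha
  · rw [← hτa] at h1
    rw [← h1] at ha
    exact Perm.sameCycle_apply_right.1 ha

end Encloses

/-! ### Parity of cyclic permutations and the local change at a unit square -/

/-- The 2-colouring alternates along the cycle, so returning to the start takes an even number of
steps. -/
theorem even_card_support_of_isCycle {α : Type*} [Fintype α] [DecidableEq α] {f : Perm α}
    (hf : f.IsCycle) (c : α → ZMod 2) (hc : ∀ x, f x ≠ x → c (f x) = c x + 1) :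
    Even f.support.card := by
  obtain ⟨x, hx, -⟩ := id hf
  have key : ∀ k : ℕ, c ((f ^ k) x) = c x + k := by
    intro k
    induction k with
    | zero => simp
    | succ k ih =>
      have hk : f ((f ^ k) x) ≠ (f ^ k) x := by
        rw [← Perm.mem_support, Perm.pow_apply_mem_support, Perm.mem_support]
        exact hx
      rw [pow_succ', Perm.mul_apply, hc _ hk, ih]
      push_cast; ring
  have := key (orderOf f)
  rw [pow_orderOf_eq_one, Perm.one_apply, left_eq_add, ZMod.natCast_eq_zero_iff_even,
    hf.orderOf] at this
  exact this

/-- The permutation of the vertices of a unit square by which two cycles with the same signature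
differ there; `n`, `s`, `w` tell which neighbouring cells are enclosed by both, and `t` whether
the square is enclosed by the first cycle. -/
def squarePerm (t n s w : Bool) : Perm (Bool × Bool) :=
  if n = s then
    if w then swap (false, false) (true, true) else swap (true, false) (false, true)
  else
    let c : Perm (Bool × Bool) :=
      if w = s then
        if w then swap (true, false) (true, true) * swap (true, true) (false, false)
        else swap (false, true) (false, false) * swap (false, false) (true, true)
      else
        if w then swap (false, false) (true, false) * swap (true, false) (false, true)
        else swap (true, true) (false, true) * swap (false, true) (true, false)
    if t then c else c⁻¹

/-- The position of the successor of the vertex `v` of a unit square, relative to the lower left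
vertex, when the nine cells around the square are given. -/
def squareNxt (t n e s w nw ne sw se : Bool) (v : Bool × Bool) : ℤ × ℤ :=
  match v with
  | (false, false) => (0, 0) + dirOut t w sw s
  | (true, false) => (1, 0) + dirOut e t s se
  | (false, true) => (0, 1) + dirOut n nw w t
  | (true, true) => (1, 1) + dirOut ne n t e

/-- The position of a vertex of a unit square relative to the lower left vertex. -/
def offset (v : Bool × Bool) : ℤ × ℤ := (if v.1 then 1 else 0, if v.2 then 1 else 0)

/-- The surroundings of a unit square allow it to be enclosed by exactly one of two cycles with the
same signature. -/
def SquareAmbiguous (n e s w nw ne sw se : Bool) : Prop :=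
  n.toNat + e.toNat + s.toNat + w.toNat = 2 ∧ ∀ t,
    NoCross t w sw s ∧ NoCross e t s se ∧ NoCross n nw w t ∧ NoCross ne n t e

instance (n e s w nw ne sw se : Bool) : Decidable (SquareAmbiguous n e s w nw ne sw se) := by
  unfold SquareAmbiguous; infer_instance

/-- Flipping the square only reroutes the cycle among its own four vertices: where the cycle leaves
them is unchanged. Hence the two successor maps differ by a permutation of these vertices. -/
theorem squareNxt_squarePerm : ∀ t n e s w nw ne sw se : Bool,
    SquareAmbiguous n e s w nw ne sw se →
    ∀ v, squareNxt t n e s w nw ne sw se v =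
      squareNxt (!t) n e s w nw ne sw se (squarePerm t n s w v) := by
  decide +kernel

/-- If the enclosed neighbours are opposite, all four vertices lie on the cycle. If they are
adjacent, the cycle misses exactly one vertex: the corner between them when the square is enclosed,
the opposite corner otherwise. -/
theorem card_fixed_square : ∀ t n e s w nw ne sw se : Bool,
    SquareAmbiguous n e s w nw ne sw se →
    (Finset.univ.filter fun v => squareNxt t n e s w nw ne sw se v = offset v).card =
      if n = s then 0 else 1 := by
  decide +kernel

theorem sign_squarePerm (t n s w : Bool) :
    Perm.sign (squarePerm t n s w) = if n = s then -1 else 1 := by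
  unfold squarePerm
  split_ifs <;> simp [Perm.sign_mul]

end Slitherlink

/-! ### The sign argument on the `2 × 2` blocks -/

namespace Slitherlink

open Equiv

theorem nxt_add_offset (β : ℤ → ℤ → Bool) (x y : ℤ) (v : Bool × Bool) :
    nxt β ((x, y) + offset v) = (x, y) + squareNxt (β x y) (β x (y + 1)) (β (x + 1) y)
      (β x (y - 1)) (β (x - 1) y) (β (x - 1) (y + 1)) (β (x + 1) (y + 1)) (β (x - 1) (y - 1))
      (β (x + 1) (y - 1)) v := by
  obtain ⟨a, b⟩ := v
  cases a <;> cases b <;> simp [nxt, offset, squareNxt, ← add_assoc]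

theorem color_of_adj {p q : ℤ × ℤ} (h : lattice.Adj p q) :
    ((q.1 + q.2 : ℤ) : ZMod 2) = ((p.1 + p.2 : ℤ) : ZMod 2) + 1 := by
  have h1 : (q.1 + q.2 = p.1 + p.2 + 1) ∨ (q.1 + q.2 = p.1 + p.2 - 1) := by
    obtain ⟨x, y⟩ := p
    rcases lattice_adj_iff.1 h with rfl | rfl | rfl | rfl <;> simp only <;> omega
  rcases h1 with h1 | h1 <;> rw [h1] <;> push_cast
  · rfl
  · linear_combination -two_eq_zero_zmod

namespace Encloses

variable {m n : ℕ} {C : lattice.Subgraph} {β : ℤ → ℤ → Bool}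

theorem nxt_box_iff (h : Encloses β C) (hC : IsGridCycle m n C) (p : ℤ × ℤ) :
    (1 ≤ (nxt β p).1 ∧ (nxt β p).1 ≤ m ∧ 1 ≤ (nxt β p).2 ∧ (nxt β p).2 ≤ n) ↔
      1 ≤ p.1 ∧ p.1 ≤ m ∧ 1 ≤ p.2 ∧ p.2 ≤ n := by
  by_cases hp : nxt β p = p
  · rw [hp]
  · have := h.adj_nxt hp
    exact iff_of_true (hC.box (C.edge_vert (C.adj_symm this))) (hC.box (C.edge_vert this))

theorem noCross_square (h : Encloses β C) (hC : IsGridCycle m n C) (x y : ℤ) :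
    NoCross (β x y) (β (x - 1) y) (β (x - 1) (y - 1)) (β x (y - 1)) ∧
    NoCross (β (x + 1) y) (β x y) (β x (y - 1)) (β (x + 1) (y - 1)) ∧
    NoCross (β x (y + 1)) (β (x - 1) (y + 1)) (β (x - 1) y) (β x y) ∧
    NoCross (β (x + 1) (y + 1)) (β x (y + 1)) (β x y) (β (x + 1) y) := by
  have a2 := h.noCross hC (x + 1) y
  have a3 := h.noCross hC x (y + 1)
  have a4 := h.noCross hC (x + 1) (y + 1)
  simp only [add_sub_cancel_right] at a2 a3 a4
  exact ⟨h.noCross hC x y, a2, a3, a4⟩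

/-- The successor permutation of a cycle on the vertices of the grid. -/
def boxPerm (h : Encloses β C) (hC : IsGridCycle m n C) :
    Perm {p : ℤ × ℤ // 1 ≤ p.1 ∧ p.1 ≤ m ∧ 1 ≤ p.2 ∧ p.2 ≤ n} :=
  (nxtPerm β (h.noCross hC)).subtypePerm (h.nxt_box_iff hC)

theorem isCycle_boxPerm (h : Encloses β C) (hC : IsGridCycle m n C) :
    (h.boxPerm hC).IsCycle := by
  obtain ⟨p, hp, hq⟩ := h.isCycle_nxtPerm hC
  have hpb := hC.box (C.edge_vert (h.adj_nxt hp))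
  refine ⟨⟨p, hpb⟩, fun h' => hp (congrArg Subtype.val h'), fun q hq' => ?_⟩
  exact Perm.sameCycle_subtypePerm.2 (hq fun h' => hq' (Subtype.ext h'))

theorem even_card_support_boxPerm (h : Encloses β C) (hC : IsGridCycle m n C)
    [Fintype {p : ℤ × ℤ // 1 ≤ p.1 ∧ p.1 ≤ m ∧ 1 ≤ p.2 ∧ p.2 ≤ n}] :
    Even (h.boxPerm hC).support.card := by
  refine even_card_support_of_isCycle (h.isCycle_boxPerm hC)
    (fun p => ((p.1.1 + p.1.2 : ℤ) : ZMod 2)) fun p hp => ?_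
  exact color_of_adj (C.adj_sub (h.adj_nxt fun h' => hp (Subtype.ext h')))

end Encloses

/-- The lattice point with given block and given position in the block, when the `2P × 2Q` grid is
dissected into blocks of `2 × 2` vertices. -/
def blockEquiv (P Q : ℕ) : (Fin P × Fin Q) × (Bool × Bool) ≃
    {p : ℤ × ℤ // 1 ≤ p.1 ∧ p.1 ≤ (2 * P : ℕ) ∧ 1 ≤ p.2 ∧ p.2 ≤ (2 * Q : ℕ)} where
  toFun v := ⟨(2 * (v.1.1 : ℤ) + 1, 2 * (v.1.2 : ℤ) + 1) + offset v.2, by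
    obtain ⟨⟨⟨i, hi⟩, ⟨j, hj⟩⟩, ⟨a, b⟩⟩ := v
    cases a <;> cases b <;> simp [offset] <;> omega⟩
  invFun p := ((⟨((p.1.1 - 1) / 2).toNat, by have := p.2; omega⟩,
    ⟨((p.1.2 - 1) / 2).toNat, by have := p.2; omega⟩),
    (decide (p.1.1 % 2 = 0), decide (p.1.2 % 2 = 0)))
  left_inv v := by
    obtain ⟨⟨⟨i, hi⟩, ⟨j, hj⟩⟩, ⟨a, b⟩⟩ := v
    cases a <;> cases b <;> simp [offset] <;> omega
  right_inv p := by
    obtain ⟨⟨x, y⟩, h⟩ := p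
    simp only at h
    apply Subtype.ext
    rcases Int.emod_two_eq_zero_or_one x with hx | hx <;>
    rcases Int.emod_two_eq_zero_or_one y with hy | hy <;>
    simp [offset, hx, hy] <;> omega

/-- If two cycles with the same signature differ exactly along the odd unit squares, then the number
of these squares is even. -/
theorem even_mul_of_squares {P Q : ℕ} {C₁ C₂ : lattice.Subgraph} {β₁ β₂ : ℤ → ℤ → Bool}
    (hC₁ : IsGridCycle (2 * P) (2 * Q) C₁) (hC₂ : IsGridCycle (2 * P) (2 * Q) C₂)
    (h₁ : Encloses β₁ C₁) (h₂ : Encloses β₂ C₂)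
    (hodd : ∀ (i : Fin P) (j : Fin Q), β₂ (2 * (i : ℤ) + 1) (2 * (j : ℤ) + 1) =
      !β₁ (2 * (i : ℤ) + 1) (2 * (j : ℤ) + 1))
    (heven : ∀ x y : ℤ, ¬(x % 2 = 1 ∧ y % 2 = 1) → β₁ x y = β₂ x y)
    (hsum : ∀ (i : Fin P) (j : Fin Q),
      (β₁ (2 * (i : ℤ) + 1) (2 * (j : ℤ) + 1 + 1)).toNat +
      (β₁ (2 * (i : ℤ) + 1 + 1) (2 * (j : ℤ) + 1)).toNat +
      (β₁ (2 * (i : ℤ) + 1) (2 * (j : ℤ) + 1 - 1)).toNat +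
      (β₁ (2 * (i : ℤ) + 1 - 1) (2 * (j : ℤ) + 1)).toNat = 2) :
    Even (P * Q) := by
  classical
  set V := (Fin P × Fin Q) × (Bool × Bool)
  set e := blockEquiv P Q with he
  let _ := Fintype.ofEquiv V e
  set σ₁ := h₁.boxPerm hC₁ with hσ₁
  set σ₂ := h₂.boxPerm hC₂ with hσ₂
  set π : Fin P × Fin Q → Perm (Bool × Bool) := fun S =>
    squarePerm (β₁ (2 * (S.1 : ℤ) + 1) (2 * (S.2 : ℤ) + 1))
      (β₁ (2 * (S.1 : ℤ) + 1) (2 * (S.2 : ℤ) + 1 + 1))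
      (β₁ (2 * (S.1 : ℤ) + 1) (2 * (S.2 : ℤ) + 1 - 1))
      (β₁ (2 * (S.1 : ℤ) + 1 - 1) (2 * (S.2 : ℤ) + 1)) with hπ
  have hamb : ∀ S : Fin P × Fin Q, SquareAmbiguous
      (β₁ (2 * (S.1 : ℤ) + 1) (2 * (S.2 : ℤ) + 1 + 1))
      (β₁ (2 * (S.1 : ℤ) + 1 + 1) (2 * (S.2 : ℤ) + 1))
      (β₁ (2 * (S.1 : ℤ) + 1) (2 * (S.2 : ℤ) + 1 - 1))
      (β₁ (2 * (S.1 : ℤ) + 1 - 1) (2 * (S.2 : ℤ) + 1))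
      (β₁ (2 * (S.1 : ℤ) + 1 - 1) (2 * (S.2 : ℤ) + 1 + 1))
      (β₁ (2 * (S.1 : ℤ) + 1 + 1) (2 * (S.2 : ℤ) + 1 + 1))
      (β₁ (2 * (S.1 : ℤ) + 1 - 1) (2 * (S.2 : ℤ) + 1 - 1))
      (β₁ (2 * (S.1 : ℤ) + 1 + 1) (2 * (S.2 : ℤ) + 1 - 1)) := by
    rintro ⟨i, j⟩
    refine ⟨hsum i j, fun t => ?_⟩
    -- The two states of the square are realised by the two cycles, whose surroundings agree; each
    -- cycle rules out checkerboards for its own state.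
    by_cases ht : t = β₁ (2 * (i : ℤ) + 1) (2 * (j : ℤ) + 1)
    · rw [ht]
      exact h₁.noCross_square hC₁ _ _
    · have hc := h₂.noCross_square hC₂ (2 * (i : ℤ) + 1) (2 * (j : ℤ) + 1)
      rw [hodd, ← heven _ _ (by omega), ← heven _ _ (by omega), ← heven _ _ (by omega),
        ← heven _ _ (by omega), ← heven _ _ (by omega), ← heven _ _ (by omega),
        ← heven _ _ (by omega), ← heven _ _ (by omega)] at hc
      rwa [show t = !β₁ (2 * (i : ℤ) + 1) (2 * (j : ℤ) + 1) from Bool.eq_not.2 ht]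
  have hnxt : ∀ v : V, σ₁ (e v) = σ₂ (e (prodCongrRight π v)) := by
    rintro ⟨S, v⟩
    apply Subtype.ext
    change nxt β₁ ((2 * (S.1 : ℤ) + 1, 2 * (S.2 : ℤ) + 1) + offset v) =
      nxt β₂ ((2 * (S.1 : ℤ) + 1, 2 * (S.2 : ℤ) + 1) + offset (π S v))
    rw [nxt_add_offset, nxt_add_offset, squareNxt_squarePerm _ _ _ _ _ _ _ _ _ (hamb S) v,
      hodd S.1 S.2, ← heven _ _ (by omega), ← heven _ _ (by omega), ← heven _ _ (by omega),
      ← heven _ _ (by omega), ← heven _ _ (by omega), ← heven _ _ (by omega),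
      ← heven _ _ (by omega), ← heven _ _ (by omega)]
  have hprod : σ₁ = σ₂ * e.permCongr (prodCongrRight π) := by
    ext1 b
    have := hnxt (e.symm b)
    simpa using this
  have hB₁ := h₁.even_card_support_boxPerm hC₁
  have hB₂ := h₂.even_card_support_boxPerm hC₂
  -- Both successor permutations are cycles of even length, hence odd, so the product of the block
  -- permutations is even. This makes the number of blocks with opposite enclosed neighbours even.
  have hsign := congrArg Perm.sign hprod
  rw [Perm.sign_mul, Perm.sign_permCongr, Perm.sign_prodCongrRight,
    (h₁.isCycle_boxPerm hC₁).sign, (h₂.isCycle_boxPerm hC₂).sign, hB₁.neg_one_pow,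
    hB₂.neg_one_pow] at hsign
  simp only [hπ, sign_squarePerm] at hsign
  rw [Finset.prod_ite, Finset.prod_const_one, mul_one, Finset.prod_const, left_eq_mul,
    neg_one_pow_eq_one_iff_even (by decide)] at hsign
  -- The fixed points of the successor map are counted block by block: one for each block with
  -- adjacent enclosed neighbours. Since the total `4 * P * Q` and the support are even, so is the
  -- number of these blocks.
  have hfix : (Finset.univ.filter fun v : V => σ₁ (e v) = e v).card =
      (Finset.univ.filter fun S : Fin P × Fin Q =>
        ¬ β₁ (2 * (S.1 : ℤ) + 1) (2 * (S.2 : ℤ) + 1 + 1) =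
        β₁ (2 * (S.1 : ℤ) + 1) (2 * (S.2 : ℤ) + 1 - 1)).card := by
    rw [Finset.card_filter, Fintype.sum_prod_type, Finset.card_filter]
    refine Finset.sum_congr rfl fun S _ => ?_
    rw [← Finset.card_filter, ite_not, ← card_fixed_square _ _ _ _ _ _ _ _ _ (hamb S)]
    congr 1
    ext v
    simp only [Finset.mem_filter, Finset.mem_univ, true_and]
    rw [Subtype.ext_iff]
    change nxt β₁ ((2 * (S.1 : ℤ) + 1, 2 * (S.2 : ℤ) + 1) + offset v) =
      ((2 * (S.1 : ℤ) + 1, 2 * (S.2 : ℤ) + 1) + offset v) ↔ _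
    rw [nxt_add_offset]
    exact add_right_inj _
  have hsupp : (Finset.univ.filter fun v : V => ¬ σ₁ (e v) = e v).card = σ₁.support.card := by
    refine Finset.card_equiv e fun v => ?_
    simp
  have htot := Finset.card_filter_add_card_filter_not (s := (Finset.univ : Finset V))
    (fun v => σ₁ (e v) = e v)
  have htot' := Finset.card_filter_add_card_filter_not (s := (Finset.univ : Finset (Fin P × Fin Q)))
    (fun S => β₁ (2 * (S.1 : ℤ) + 1) (2 * (S.2 : ℤ) + 1 + 1) =
        β₁ (2 * (S.1 : ℤ) + 1) (2 * (S.2 : ℤ) + 1 - 1))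
  rw [hfix, hsupp] at htot
  simp only [V, Finset.card_univ, Fintype.card_prod, Fintype.card_fin, Fintype.card_bool]
    at htot htot'
  rw [← hσ₁, Nat.even_iff] at hB₁
  rw [Nat.even_iff] at hsign ⊢
  omega

end Slitherlink

/-! ### Uniqueness: from signatures to the wave equation -/

namespace Slitherlink

namespace IsInterior

variable {m n : ℕ} {C C₁ C₂ : lattice.Subgraph} {g g₁ g₂ : ℤ → ℤ → ZMod 2}

theorem add_eq_natCast_ind {a b : ZMod 2} {E : Set (Sym2 (ℤ × ℤ))} {e : Sym2 (ℤ × ℤ)}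
    (h : a + b = ind E e) : e ∈ E ↔ decide (a = 1) ≠ decide (b = 1) := by
  have key : ∀ a b : ZMod 2, (decide (a = 1) ≠ decide (b = 1) ↔ a + b = 1) := by decide
  rw [key, h]
  by_cases he : e ∈ E
  · simp [ind_of_mem he, he]
  · simp [ind_of_notMem he, he]

theorem encloses (h : IsInterior m n C g) : Encloses (fun x y => decide (g x y = 1)) C :=
  ⟨fun x y => add_eq_natCast_ind (h.vert x y), fun x y => add_eq_natCast_ind (h.horiz x y)⟩

/-- Each side contributes the cell's own value plus that of the neighbour across it; the four copies
of the own value cancel modulo 2. -/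
theorem cellSum_cast (h : IsInterior m n C g) (x y : ℤ) : (cellSum C.edgeSet x y : ZMod 2) =
    g (x - 1) y + g (x + 1) y + g x (y - 1) + g x (y + 1) := by
  have e1 := h.horiz x (y + 1)
  have e2 := h.vert (x + 1) y
  rw [add_sub_cancel_right] at e1 e2
  rw [cellSum]
  push_cast
  rw [← h.horiz x y, ← h.vert x y, ← e1, ← e2]
  linear_combination 2 * g x y * two_eq_zero_zmod

theorem edgeSet_eq_of_eq (h₁ : IsInterior m n C₁ g₁) (h₂ : IsInterior m n C₂ g₂)
    (h : ∀ x y, g₁ x y + g₂ x y = 0) : C₁.edgeSet = C₂.edgeSet := by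
  have hg : g₁ = g₂ := by
    funext x y
    have key : ∀ a b : ZMod 2, a + b = 0 → a = b := by decide
    exact key _ _ (h x y)
  subst hg
  refine edgeSet_ext (fun x y => ?_) (fun x y => ?_)
  · rw [h₁.encloses.horiz, h₂.encloses.horiz]
  · rw [h₁.encloses.vert, h₂.encloses.vert]

end IsInterior

theorem Encloses.cellSum_eq {C : lattice.Subgraph} {β : ℤ → ℤ → Bool} (h : Encloses β C)
    (x y : ℤ) : cellSum C.edgeSet x y = (β x (y + 1) ^^ β x y).toNat + (β (x + 1) y ^^ β x y).toNat +
      (β x (y - 1) ^^ β x y).toNat + (β (x - 1) y ^^ β x y).toNat := by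
  have key : ∀ {e a b}, (e ∈ C.edgeSet ↔ a ≠ b) → ind C.edgeSet e = (a ^^ b).toNat := by
    intro e a b he
    by_cases h' : e ∈ C.edgeSet
    · rw [ind_of_mem h']
      have := he.1 h'
      revert this; cases a <;> cases b <;> simp
    · rw [ind_of_notMem h']
      have := mt he.2 h'
      revert this; cases a <;> cases b <;> simp
  have e1 := h.horiz x (y + 1)
  have e2 := h.vert (x + 1) y
  rw [add_sub_cancel_right] at e1 e2
  rw [cellSum, key (h.horiz x y), key (h.vert x y), key e1, key e2, Bool.xor_comm (β x y),
    Bool.xor_comm (β x y)]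
  ring

/-- A cycle is determined by its signature when the dimensions of the grid are as stated. -/
theorem eq_of_signature_eq {m n : ℕ} (hm : 0 < m) (hn : 0 < n)
    (hmn : (m ≤ 2 ∨ n ≤ 2) ∨ Nat.gcd m n = 1 ∨
      (Nat.gcd m n = 2 ∧ m ≡ 2 [MOD 4] ∧ n ≡ 2 [MOD 4]))
    {C₁ C₂ : lattice.Subgraph} (hC₁ : IsGridCycle m n C₁) (hC₂ : IsGridCycle m n C₂)
    (hsig : signature m n C₁ = signature m n C₂) : C₁ = C₂ := by
  obtain ⟨g₁, h₁⟩ := hC₁.exists_isInterior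
  obtain ⟨g₂, h₂⟩ := hC₂.exists_isInterior
  refine hC₁.eq_of_edgeSet_eq hC₂ ?_
  rw [signature_eq_iff] at hsig
  set g : ℤ → ℤ → ZMod 2 := fun x y => g₁ x y + g₂ x y with hg
  have hout : ∀ x y : ℤ, ¬(1 ≤ x ∧ x + 1 ≤ m ∧ 1 ≤ y ∧ y + 1 ≤ n) → g x y = 0 := fun x y h => by
    simp only [hg, h₁.outside x y h, h₂.outside x y h, add_zero]
  have hw : ∀ x y : ℤ, 1 ≤ x → x + 1 ≤ m → 1 ≤ y → y + 1 ≤ n →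
      g (x - 1) y + g (x + 1) y + g x (y - 1) + g x (y + 1) = 0 := by
    intro x y a b c d
    have e1 := h₁.cellSum_cast x y
    rw [hsig x y a b c d, h₂.cellSum_cast] at e1
    simp only [hg]
    linear_combination e1 + (g₁ (x - 1) y + g₁ (x + 1) y + g₁ x (y - 1) + g₁ x (y + 1)) *
      two_eq_zero_zmod
  by_contra hne
  have hgne : ¬ ∀ x y, g x y = 0 := fun h => hne (h₁.edgeSet_eq_of_eq h₂ h)
  have hd1 : Nat.gcd m n ≠ 1 := fun hd => hgne (wave_eq_zero_of_coprime hm hn hd hout hw)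
  have hd0 : 0 < Nat.gcd m n := Nat.gcd_pos_of_pos_left _ hm
  -- If `m ≤ 2` or `n ≤ 2`, the gcd is at most 2, so after excluding 1 every listed condition leaves
  -- the same value.
  have hd2 : Nat.gcd m n = 2 := by
    have := Nat.gcd_le_left n hm
    have := Nat.gcd_le_right m hn
    omega
  have hgeq := wave_of_gcd_eq_two hm hn hd2 hout hw
  have hm2 : m % 2 = 0 := Nat.mod_eq_zero_of_dvd (hd2 ▸ Nat.gcd_dvd_left m n)
  have hn2 : n % 2 = 0 := Nat.mod_eq_zero_of_dvd (hd2 ▸ Nat.gcd_dvd_right m n)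
  have hg1 : g 1 1 = 1 := by
    have key : ∀ a : ZMod 2, a ≠ 0 → a = 1 := by decide
    refine key _ fun h0 => hgne fun x y => ?_
    by_cases hxy : 1 ≤ x ∧ x + 1 ≤ m ∧ 1 ≤ y ∧ y + 1 ≤ n
    · rw [hgeq x y (by omega) (by omega) (by omega) (by omega), h0, ite_self]
    · exact hout _ _ hxy
  set β₁ : ℤ → ℤ → Bool := fun x y => decide (g₁ x y = 1) with hβ₁
  set β₂ : ℤ → ℤ → Bool := fun x y => decide (g₂ x y = 1) with hβ₂
  have hE₁ : Encloses β₁ C₁ := h₁.encloses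
  have hE₂ : Encloses β₂ C₂ := h₂.encloses
  have heven : ∀ x y : ℤ, ¬(x % 2 = 1 ∧ y % 2 = 1) → β₁ x y = β₂ x y := by
    intro x y hxy
    have key : ∀ a b : ZMod 2, a + b = 0 → decide (a = 1) = decide (b = 1) := by decide
    apply key
    change g x y = 0
    by_cases hb : 1 ≤ x ∧ x + 1 ≤ m ∧ 1 ≤ y ∧ y + 1 ≤ n
    · rw [hgeq x y (by omega) (by omega) (by omega) (by omega), if_neg hxy]
    · exact hout _ _ hb
  have hodd : ∀ x y : ℤ, 1 ≤ x → x + 1 ≤ m → 1 ≤ y → y + 1 ≤ n → x % 2 = 1 → y % 2 = 1 →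
      β₂ x y = !β₁ x y := by
    intro x y a b c d hx hy
    have key : ∀ a b : ZMod 2, a + b = 1 → decide (b = 1) = !decide (a = 1) := by decide
    apply key
    change g x y = 1
    rw [hgeq x y (by omega) (by omega) (by omega) (by omega), if_pos ⟨hx, hy⟩, hg1]
  have hsum : ∀ x y : ℤ, 1 ≤ x → x + 1 ≤ m → 1 ≤ y → y + 1 ≤ n → x % 2 = 1 → y % 2 = 1 →
      (β₁ x (y + 1)).toNat + (β₁ (x + 1) y).toNat + (β₁ x (y - 1)).toNat +
        (β₁ (x - 1) y).toNat = 2 := by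
    intro x y a b c d hx hy
    have := hsig x y a b c d
    rw [hE₁.cellSum_eq, hE₂.cellSum_eq, hodd x y a b c d hx hy, ← heven _ _ (by omega),
      ← heven _ _ (by omega), ← heven _ _ (by omega), ← heven _ _ (by omega)] at this
    -- Flipping the cell replaces its count `c` by `4 - c`, so equality forces `c = 2`. This is
    -- where the integer signature is used rather than its parity.
    have key : ∀ t p q r s : Bool,
        (p ^^ t).toNat + (q ^^ t).toNat + (r ^^ t).toNat + (s ^^ t).toNat =
        (p ^^ !t).toNat + (q ^^ !t).toNat + (r ^^ !t).toNat + (s ^^ !t).toNat →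
        p.toNat + q.toNat + r.toNat + s.toNat = 2 := by decide
    exact key _ _ _ _ _ this
  have hβout : ∀ x y : ℤ, ¬(1 ≤ x ∧ x + 1 ≤ m ∧ 1 ≤ y ∧ y + 1 ≤ n) → (β₁ x y).toNat = 0 := by
    intro x y h
    simp [hβ₁, h₁.outside x y h]
  have hle : ∀ x y, (β₁ x y).toNat ≤ 1 := fun x y => Bool.toNat_le _
  -- The corner cell has two neighbours outside the grid, so the other two must both be enclosed;
  -- this excludes grids of width or height 2.
  have hcorner := hsum 1 1 le_rfl (by omega) le_rfl (by omega) rfl rfl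
  rw [hβout 1 (1 - 1) (by omega), hβout (1 - 1) 1 (by omega)] at hcorner
  by_cases hm' : m ≤ 2
  · rw [hβout (1 + 1) 1 (by omega)] at hcorner
    have := hle 1 (1 + 1)
    omega
  by_cases hn' : n ≤ 2
  · rw [hβout 1 (1 + 1) (by omega)] at hcorner
    have := hle (1 + 1) 1
    omega
  obtain ⟨P, rfl⟩ : ∃ P, m = 2 * P := ⟨m / 2, by omega⟩
  obtain ⟨Q, rfl⟩ : ∃ Q, n = 2 * Q := ⟨n / 2, by omega⟩
  have hev := even_mul_of_squares hC₁ hC₂ hE₁ hE₂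
    (fun i j => hodd _ _ (by omega) (by omega) (by omega) (by omega) (by omega) (by omega)) heven
    (fun i j => hsum _ _ (by omega) (by omega) (by omega) (by omega) (by omega) (by omega))
  rw [Nat.even_mul, Nat.even_iff, Nat.even_iff] at hev
  simp only [Nat.ModEq] at hmn
  omega

end Slitherlink

/-! ### Surgery on paths and cycles given by edge sets -/

namespace Slitherlink

open SimpleGraph

section Walks

variable {V : Type*} {G : SimpleGraph V}

theorem isPath_append_of_inter {u v w : V} {p : G.Walk u v} {q : G.Walk v w} (hp : p.IsPath)
    (hq : q.IsPath) (h : ∀ x ∈ p.support, x ∈ q.support → x = v) : (p.append q).IsPath := by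
  rw [Walk.isPath_def, Walk.support_append]
  have hqs : q.support = v :: q.support.tail := q.cons_tail_support.symm
  have hqn := hq.support_nodup
  rw [hqs, List.nodup_cons] at hqn
  refine List.nodup_append.2 ⟨hp.support_nodup, hqn.2, fun x hx y hy hxy => ?_⟩
  subst hxy
  have := h x hx (by rw [hqs]; exact List.mem_cons_of_mem _ hy)
  exact hqn.1 (this ▸ hy)

/-- `E` is the edge set of a cycle of `G`. -/
def IsCycleSet (G : SimpleGraph V) (E : Set (Sym2 V)) : Prop :=
  ∃ (v : V) (w : G.Walk v v), w.IsCycle ∧ w.edgeSet = E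

/-- `S` is the edge set of a path of `G` from `a` to `b`. -/
def IsPathSet (G : SimpleGraph V) (a b : V) (S : Set (Sym2 V)) : Prop :=
  ∃ p : G.Walk a b, p.IsPath ∧ p.edgeSet = S

theorem IsPathSet.symm {a b : V} {S : Set (Sym2 V)} (h : IsPathSet G a b S) :
    IsPathSet G b a S := by
  obtain ⟨p, hp, rfl⟩ := h
  exact ⟨p.reverse, hp.reverse, p.edgeSet_reverse⟩

theorem IsPathSet.cons {a b c : V} {S : Set (Sym2 V)} (h : IsPathSet G b c S) (hab : G.Adj a b)
    (hac : a ≠ c) (ha : ∀ e ∈ S, a ∉ e) : IsPathSet G a c (insert s(a, b) S) := by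
  obtain ⟨p, hp, rfl⟩ := h
  refine ⟨.cons hab p, hp.cons fun h => ?_, p.edgeSet_cons hab⟩
  rcases Walk.mem_support_iff_exists_mem_edges.1 h with h | ⟨e, he, h⟩
  · exact hac h
  · exact ha e he h

theorem IsPathSet.single {a b : V} (h : G.Adj a b) : IsPathSet G a b {s(a, b)} :=
  ⟨.cons h .nil, by simp [h.ne], by ext; simp [Walk.edgeSet]⟩

/-- Disjointness is expressed through edges. A trivial path has a vertex but no edge, which is why
the outer endpoints need hypotheses of their own. -/
theorem IsPathSet.append {a b c : V} {S T : Set (Sym2 V)} (hS : IsPathSet G a b S)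
    (hT : IsPathSet G b c T) (ha : ∀ e ∈ T, a ∉ e) (hac : a ≠ c) (hcS : ∀ e ∈ S, c ∉ e)
    (h : ∀ x, ∀ e ∈ S, ∀ f ∈ T, x ∈ e → x ∈ f → x = b) : IsPathSet G a c (S ∪ T) := by
  obtain ⟨p, hp, rfl⟩ := hS
  obtain ⟨q, hq, rfl⟩ := hT
  refine ⟨p.append q, isPath_append_of_inter hp hq fun x hx hx' => ?_, p.edgeSet_append q⟩
  rw [← List.mem_reverse, ← Walk.support_reverse, Walk.mem_support_iff_exists_mem_edges] at hx
  rw [Walk.mem_support_iff_exists_mem_edges] at hx'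
  rcases hx with rfl | ⟨e, he, hx⟩
  · rcases hx' with h' | ⟨f, hf, hx'⟩
    · exact (hac h').elim
    · exact (ha f hf hx').elim
  · rw [Walk.edges_reverse, List.mem_reverse] at he
    rcases hx' with rfl | ⟨f, hf, hx'⟩
    · exact (hcS e he hx).elim
    · exact h x e he f hf hx hx'

/-- After rotating the cycle to start at `a`, the given edge is the first or the last one; reversing
the walk reduces the second case to the first. -/
theorem IsCycleSet.open_edge {E : Set (Sym2 V)} (h : IsCycleSet G E) {a b : V}
    (hab : s(a, b) ∈ E) : IsPathSet G a b (E \ {s(a, b)}) := by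
  classical
  obtain ⟨v, w, hw, rfl⟩ := h
  have ha : a ∈ w.support := w.fst_mem_support_of_mem_edges hab
  have hrot : (w.rotate a ha).edgeSet = w.edgeSet := by
    ext e
    exact (w.rotate_edges a ha).mem_iff
  rw [← hrot] at hab ⊢
  replace hw := hw.rotate ha
  generalize w.rotate a ha = w' at *
  -- It suffices to treat a cycle whose first edge is the given one.
  have key : ∀ (c : V) (hc : G.Adj a c) (q : G.Walk c a), (Walk.cons hc q).IsCycle → c = b →
      IsPathSet G a b ((Walk.cons hc q).edgeSet \ {s(a, b)}) := by
    rintro c hc q hq rfl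
    rw [Walk.cons_isCycle_iff] at hq
    refine ⟨q.reverse, hq.1.reverse, ?_⟩
    rw [Walk.edgeSet_reverse, Walk.edgeSet_cons,
      Set.insert_sdiff_self_of_notMem (show s(a, c) ∉ q.edgeSet from hq.2)]
  cases w' with
  | nil => simp at hw
  | @cons _ c _ hc q =>
    by_cases hcb : c = b
    · exact key c hc q hw hcb
    · have hab' : s(a, b) ∈ q.edges := by
        have : s(a, b) = s(a, c) ∨ s(a, b) ∈ q.edges := by simpa [Walk.edgeSet] using hab
        rcases this with h | h
        · exact (hcb (Sym2.congr_right.1 h).symm).elim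
        · exact h
      have hq := (Walk.cons_isCycle_iff q hc).1 hw
      -- The remaining walk is a path ending at `a`, so its only edge at `a` is its last one.
      have hpen := hq.1.eq_penultimate_of_mem_edges hab'
      have hr := hw.reverse
      rw [← Walk.edgeSet_reverse]
      have hsnd : (Walk.cons hc q).reverse.snd = b := by
        rw [Walk.snd_reverse, hpen, Walk.penultimate_cons_of_not_nil]
        exact Walk.not_nil_of_isCycle_cons hw
      generalize (Walk.cons hc q).reverse = r at hr hsnd ⊢
      cases r with
      | nil => simp at hr
      | cons hc' q' => exact key _ hc' q' hr (by simpa using hsnd)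

theorem IsPathSet.close {a b : V} {S : Set (Sym2 V)} (h : IsPathSet G a b S) (hab : G.Adj b a)
    (hS : s(b, a) ∉ S) : IsCycleSet G (insert s(b, a) S) := by
  obtain ⟨p, hp, rfl⟩ := h
  exact ⟨b, .cons hab p, (Walk.cons_isCycle_iff p hab).2 ⟨hp, hS⟩, p.edgeSet_cons hab⟩

/-- An edge of a cycle can be replaced by a path which does not meet the cycle. -/
theorem IsCycleSet.replace {E S : Set (Sym2 V)} (hE : IsCycleSet G E) {a b c : V}
    (hab : s(a, b) ∈ E) (hac : G.Adj a c) (hS : IsPathSet G c b S)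
    (hcE : ∀ e ∈ E, c ∉ e) (haS : ∀ e ∈ S, a ∉ e)
    (h : ∀ x, ∀ e ∈ E, ∀ f ∈ S, x ∈ e → x ∈ f → x = b) :
    IsCycleSet G ((E \ {s(a, b)}) ∪ insert s(a, c) S) := by
  -- The opened cycle runs from `b` to `a`; preceding it by the new path from `c` to `b` gives a
  -- path from `c` to `a`, which the edge `s(a, c)` closes.
  have hp := (hE.open_edge hab).symm
  have hr := (hS.append hp (fun e he => hcE e he.1) (fun hca => ?_) haS
    fun x e he f hf hx hx' => h x f hf.1 e he hx' hx).close hac ?_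
  · convert hr using 1
    ext e
    simp only [Set.mem_union, Set.mem_insert_iff]
    tauto
  · exact hcE _ hab (hca ▸ Sym2.mem_mk_left a b)
  · rintro (h' | h')
    · exact haS _ h' (Sym2.mem_mk_left _ _)
    · exact hcE _ h'.1 (Sym2.mem_mk_right _ _)

/-- Two disjoint cycles can be merged along a square with two opposite edges on them. -/
theorem IsCycleSet.merge {E F : Set (Sym2 V)} (hE : IsCycleSet G E) (hF : IsCycleSet G F)
    (hd : ∀ x, ∀ e ∈ E, ∀ f ∈ F, x ∈ e → x ∉ f) {a b c d : V} (hab : s(a, b) ∈ E)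
    (hcd : s(c, d) ∈ F) (hac : G.Adj a c) (hbd : G.Adj b d) (hne : a ≠ b) :
    IsCycleSet G ((E \ {s(a, b)}) ∪ ({s(a, c), s(b, d)} ∪ (F \ {s(c, d)}))) := by
  have hq := (((hF.open_edge hcd).symm.cons hbd
    (fun h => hd b _ hab _ hcd (by simp) (by simp [h]))
    fun e he h => hd b _ hab _ he.1 (by simp) h)).symm
  have := hE.replace hab hac hq (fun e he h => hd c _ he _ hcd h (by simp)) ?_ ?_
  · convert this using 2
    ext e
    simp only [Set.mem_union, Set.mem_insert_iff, Set.mem_singleton_iff]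
    tauto
  · rintro e (rfl | he) h
    · rcases Sym2.mem_iff.1 h with h | h
      · exact hne h
      · exact hd a _ hab _ hcd (by simp) (by simp [h])
    · exact hd a _ hab _ he.1 (by simp) h
  · rintro x e he f (rfl | hf) hx hx'
    · rcases Sym2.mem_iff.1 hx' with h | rfl
      · exact h
      · exact (hd x _ he _ hcd hx (by simp)).elim
    · exact (hd x _ he _ hf.1 hx hx').elim

/-- An edge of a cycle can be replaced by the other three edges of a square. -/
theorem IsCycleSet.detour {E : Set (Sym2 V)} (hE : IsCycleSet G E) {a b c d : V}
    (hab : s(a, b) ∈ E) (hac : G.Adj a c) (hcd : G.Adj c d) (hbd : G.Adj b d) (hne : a ≠ b)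
    (hc : ∀ e ∈ E, c ∉ e) (hd : ∀ e ∈ E, d ∉ e) :
    IsCycleSet G ((E \ {s(a, b)}) ∪ {s(a, c), s(c, d), s(b, d)}) := by
  have hcb : c ≠ b := fun h => hc _ hab (by simp [h])
  have hca : c ≠ a := fun h => hc _ hab (by simp [h])
  have hda : d ≠ a := fun h => hd _ hab (by simp [h])
  have hdb : d ≠ b := fun h => hd _ hab (by simp [h])
  have hq : IsPathSet G c b {s(c, d), s(b, d)} := by
    rw [Sym2.eq_swap (a := b)]
    exact (IsPathSet.single hbd.symm).cons hcd hcb fun e he h => by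
      rw [Set.mem_singleton_iff.1 he] at h
      rcases Sym2.mem_iff.1 h with h | h
      · exact hcd.ne h
      · exact hcb h
  refine hE.replace hab hac hq hc ?_ ?_
  · rintro e (rfl | rfl) h <;> rcases Sym2.mem_iff.1 h with h | h <;> simp_all
  · rintro x e he f (rfl | rfl) hx hx' <;> rcases Sym2.mem_iff.1 hx' with rfl | rfl
    · exact (hc _ he hx).elim
    · exact (hd _ he hx).elim
    · rfl
    · exact (hd _ he hx).elim

theorem IsCycleSet.preimage {E : Set (Sym2 V)} (hE : IsCycleSet G E) (φ : G ≃g G) :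
    IsCycleSet G (Sym2.map φ ⁻¹' E) := by
  obtain ⟨v, w, hw, rfl⟩ := hE
  refine ⟨_, w.map φ.symm.toHom,
    (Walk.isCycle_map_iff_of_injective φ.symm.injective).2 hw, ?_⟩
  rw [Walk.edgeSet_map]
  ext e
  constructor
  · rintro ⟨f, hf, rfl⟩
    have : Sym2.map φ (Sym2.map φ.symm.toHom f) = f := by
      induction f using Sym2.ind; simp
    rw [Set.mem_preimage, this]; exact hf
  · intro he
    refine ⟨_, he, ?_⟩
    induction e using Sym2.ind; simp

end Walks

end Slitherlink

/-! ### Lattice symmetries and gluing of ambiguous grids -/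

namespace Slitherlink

open SimpleGraph

theorem hEdge_inj {x y x' y' : ℤ} : hEdge x y = hEdge x' y' ↔ x = x' ∧ y = y' := by
  simp only [hEdge, Sym2.eq_iff, Prod.mk.injEq]
  omega

theorem vEdge_inj {x y x' y' : ℤ} : vEdge x y = vEdge x' y' ↔ x = x' ∧ y = y' := by
  simp only [vEdge, Sym2.eq_iff, Prod.mk.injEq]
  omega

theorem hEdge_ne_vEdge {x y x' y' : ℤ} : hEdge x y ≠ vEdge x' y' := by
  simp only [hEdge, vEdge, ne_eq, Sym2.eq_iff, Prod.mk.injEq]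
  omega

theorem vEdge_ne_hEdge {x y x' y' : ℤ} : vEdge x y ≠ hEdge x' y' := hEdge_ne_vEdge.symm

theorem adj_right (x y : ℤ) : lattice.Adj (x, y) (x + 1, y) := by simp [lattice]

theorem adj_up (x y : ℤ) : lattice.Adj (x, y) (x, y + 1) := by simp [lattice]

/-- The translation of the lattice by `(-k, -l)`. -/
def shiftIso (k l : ℤ) : lattice ≃g lattice where
  toFun p := (p.1 - k, p.2 - l)
  invFun p := (p.1 + k, p.2 + l)
  left_inv p := by simp
  right_inv p := by simp
  map_rel_iff' := by intro p q; simp only [lattice, Equiv.coe_fn_mk]; omega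

/-- The reflection of the lattice which exchanges the sides of a grid of width `m`. -/
def mirrorIso (m : ℤ) : lattice ≃g lattice where
  toFun p := (m + 1 - p.1, p.2)
  invFun p := (m + 1 - p.1, p.2)
  left_inv p := by simp
  right_inv p := by simp
  map_rel_iff' := by intro p q; simp only [lattice, Equiv.coe_fn_mk]; omega

/-- The reflection of the lattice in the diagonal. -/
def swapIso : lattice ≃g lattice where
  toFun p := (p.2, p.1)
  invFun p := (p.2, p.1)
  left_inv p := by simp
  right_inv p := by simp
  map_rel_iff' := by intro p q; simp only [lattice, Equiv.coe_fn_mk]; omega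

/-- The translate of a set of edges by `(k, l)`. -/
def shift (k l : ℤ) (E : Set (Sym2 (ℤ × ℤ))) : Set (Sym2 (ℤ × ℤ)) := Sym2.map (shiftIso k l) ⁻¹' E

/-- The mirror image of a set of edges of a grid of width `m`. -/
def mirror (m : ℤ) (E : Set (Sym2 (ℤ × ℤ))) : Set (Sym2 (ℤ × ℤ)) := Sym2.map (mirrorIso m) ⁻¹' E

/-- The transpose of a set of edges. -/
def transpose (E : Set (Sym2 (ℤ × ℤ))) : Set (Sym2 (ℤ × ℤ)) := Sym2.map swapIso ⁻¹' E

section Membership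

variable {E : Set (Sym2 (ℤ × ℤ))} {k l m x y : ℤ}

theorem hEdge_mem_shift : hEdge x y ∈ shift k l E ↔ hEdge (x - k) (y - l) ∈ E := by
  rw [shift, Set.mem_preimage, hEdge, Sym2.map_mk, hEdge, sub_add_eq_add_sub]; rfl

theorem vEdge_mem_shift : vEdge x y ∈ shift k l E ↔ vEdge (x - k) (y - l) ∈ E := by
  rw [shift, Set.mem_preimage, vEdge, Sym2.map_mk, vEdge, sub_add_eq_add_sub]; rfl

/-- The reflection reverses the edge: its new left endpoint is the image of `x + 1`, namely `m - x`,
whereas a vertical edge goes to abscissa `m + 1 - x`. -/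
theorem hEdge_mem_mirror : hEdge x y ∈ mirror m E ↔ hEdge (m - x) y ∈ E := by
  rw [mirror, Set.mem_preimage, hEdge, Sym2.map_mk, hEdge, Sym2.eq_swap,
    show (mirrorIso m) (x + 1, y) = (m - x, y) from Prod.ext (by simp [mirrorIso]) rfl,
    show (mirrorIso m) (x, y) = (m - x + 1, y) from Prod.ext (by simp [mirrorIso]; ring) rfl]

theorem vEdge_mem_mirror : vEdge x y ∈ mirror m E ↔ vEdge (m + 1 - x) y ∈ E := Iff.rfl

theorem vEdge_mem_transpose : vEdge x y ∈ transpose E ↔ hEdge y x ∈ E := Iff.rfl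

end Membership

/-- All edges of `E` are edges of the `m × n` grid. -/
def InBox (m n : ℤ) (E : Set (Sym2 (ℤ × ℤ))) : Prop :=
  ∀ e ∈ E, ∀ p ∈ e, 1 ≤ p.1 ∧ p.1 ≤ m ∧ 1 ≤ p.2 ∧ p.2 ≤ n

namespace InBox

variable {m n : ℤ} {E F : Set (Sym2 (ℤ × ℤ))}

theorem hEdge (h : InBox m n E) {x y : ℤ} (he : hEdge x y ∈ E) :
    1 ≤ x ∧ x + 1 ≤ m ∧ 1 ≤ y ∧ y ≤ n := by
  have h1 := h _ he _ (Sym2.mem_mk_left _ _)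
  have h2 := h _ he _ (Sym2.mem_mk_right _ _)
  dsimp only at h1 h2
  omega

theorem vEdge (h : InBox m n E) {x y : ℤ} (he : vEdge x y ∈ E) :
    1 ≤ x ∧ x ≤ m ∧ 1 ≤ y ∧ y + 1 ≤ n := by
  have h1 := h _ he _ (Sym2.mem_mk_left _ _)
  have h2 := h _ he _ (Sym2.mem_mk_right _ _)
  dsimp only at h1 h2
  omega

theorem mono {m' n' : ℤ} (h : InBox m n E) (hm : m ≤ m') (hn : n ≤ n') : InBox m' n' E :=
  fun e he p hp => by have := h e he p hp; omega

theorem union (h : InBox m n E) (h' : InBox m n F) : InBox m n (E ∪ F) := by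
  rintro e (he | he)
  · exact h e he
  · exact h' e he

theorem subset (h : InBox m n E) (hF : F ⊆ E) : InBox m n F := fun e he => h e (hF he)

theorem mirror (h : InBox m n E) : InBox m n (mirror m E) := by
  intro e he p hp
  have := h _ he _ (Sym2.mem_map.2 ⟨p, hp, rfl⟩)
  simp only [mirrorIso, RelIso.coe_fn_mk, Equiv.coe_fn_mk] at this
  omega

theorem transpose (h : InBox m n E) : InBox n m (transpose E) := by
  intro e he p hp
  have := h _ he _ (Sym2.mem_map.2 ⟨p, hp, rfl⟩)
  simp only [swapIso, RelIso.coe_fn_mk, Equiv.coe_fn_mk] at this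
  omega

theorem shift (h : InBox m n E) {k l : ℤ} {e : Sym2 (ℤ × ℤ)} (he : e ∈ shift k l E)
    {p : ℤ × ℤ} (hp : p ∈ e) : k + 1 ≤ p.1 ∧ p.1 ≤ k + m ∧ l + 1 ≤ p.2 ∧ p.2 ≤ l + n := by
  have := h _ he _ (Sym2.mem_map.2 ⟨p, hp, rfl⟩)
  simp only [shiftIso, RelIso.coe_fn_mk, Equiv.coe_fn_mk] at this
  omega

end InBox

/-- The difference of the indicator functions of two sets of edges. -/
noncomputable def dif (E₁ E₂ : Set (Sym2 (ℤ × ℤ))) (e : Sym2 (ℤ × ℤ)) : ℤ := ind E₁ e - ind E₂ e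

theorem dif_congr {E₁ E₂ F₁ F₂ : Set (Sym2 (ℤ × ℤ))} {e f : Sym2 (ℤ × ℤ)}
    (h₁ : e ∈ E₁ ↔ f ∈ F₁) (h₂ : e ∈ E₂ ↔ f ∈ F₂) : dif E₁ E₂ e = dif F₁ F₂ f := by
  rw [dif, dif, ind_congr h₁, ind_congr h₂]

theorem dif_eq_zero {E₁ E₂ : Set (Sym2 (ℤ × ℤ))} {e : Sym2 (ℤ × ℤ)} (h : e ∈ E₁ ↔ e ∈ E₂) :
    dif E₁ E₂ e = 0 := by
  rw [dif, ind_congr h, sub_self]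

theorem dif_swap (E₁ E₂ : Set (Sym2 (ℤ × ℤ))) (e : Sym2 (ℤ × ℤ)) :
    dif E₂ E₁ e = -dif E₁ E₂ e := by
  rw [dif, dif, neg_sub]

/-- `E₁` and `E₂` are the edge sets of two distinct cycles in the `m × n` grid with the same
signature. -/
structure Ambiguous (m n : ℤ) (E₁ E₂ : Set (Sym2 (ℤ × ℤ))) : Prop where
  cycle₁ : IsCycleSet lattice E₁
  cycle₂ : IsCycleSet lattice E₂
  box₁ : InBox m n E₁
  box₂ : InBox m n E₂
  ne : ∃ x y, dif E₁ E₂ (hEdge x y) ≠ 0 ∨ dif E₁ E₂ (vEdge x y) ≠ 0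
  sig : ∀ x y : ℤ, 1 ≤ x → x + 1 ≤ m → 1 ≤ y → y + 1 ≤ n →
    dif E₁ E₂ (hEdge x y) + dif E₁ E₂ (hEdge x (y + 1)) + dif E₁ E₂ (vEdge x y) +
      dif E₁ E₂ (vEdge (x + 1) y) = 0

theorem dif_hEdge_mirror (m : ℤ) (E₁ E₂ : Set (Sym2 (ℤ × ℤ))) (x y : ℤ) :
    dif (mirror m E₂) (mirror m E₁) (hEdge x y) = -dif E₁ E₂ (hEdge (m - x) y) := by
  rw [dif_congr hEdge_mem_mirror hEdge_mem_mirror, dif_swap]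

theorem dif_vEdge_mirror (m : ℤ) (E₁ E₂ : Set (Sym2 (ℤ × ℤ))) (x y : ℤ) :
    dif (mirror m E₂) (mirror m E₁) (vEdge x y) = -dif E₁ E₂ (vEdge (m + 1 - x) y) := by
  rw [dif_congr vEdge_mem_mirror vEdge_mem_mirror, dif_swap]

/-- Two sets of edges in adjacent grids, the left one of width `k`, merged along the square whose
left edge is `vEdge k y₀`. -/
def glueSet (k y₀ : ℤ) (E F : Set (Sym2 (ℤ × ℤ))) : Set (Sym2 (ℤ × ℤ)) :=
  (E \ {vEdge k y₀}) ∪ ({hEdge k y₀, hEdge k (y₀ + 1)} ∪ (shift k 0 F \ {vEdge (k + 1) y₀}))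

section Glue

variable {k m n y₀ : ℤ} {E F : Set (Sym2 (ℤ × ℤ))}

theorem vEdge_mem_glueSet {x y : ℤ} : vEdge x y ∈ glueSet k y₀ E F ↔
    (vEdge x y ∈ E ∧ ¬(x = k ∧ y = y₀)) ∨ (vEdge (x - k) y ∈ F ∧ ¬(x = k + 1 ∧ y = y₀)) := by
  simp only [glueSet, Set.mem_union, Set.mem_sdiff, Set.mem_singleton_iff, Set.mem_insert_iff,
    vEdge_inj, vEdge_ne_hEdge, vEdge_mem_shift, sub_zero, false_or]

theorem hEdge_mem_glueSet {x y : ℤ} : hEdge x y ∈ glueSet k y₀ E F ↔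
    hEdge x y ∈ E ∨ ((x = k ∧ y = y₀) ∨ (x = k ∧ y = y₀ + 1)) ∨ hEdge (x - k) y ∈ F := by
  simp only [glueSet, Set.mem_union, Set.mem_sdiff, Set.mem_singleton_iff, Set.mem_insert_iff,
    hEdge_inj, hEdge_ne_vEdge, hEdge_mem_shift, sub_zero, not_false_eq_true, and_true]

theorem isCycleSet_glueSet (hE : IsCycleSet lattice E) (hF : IsCycleSet lattice F)
    (bE : InBox k n E) (bF : InBox m n F) (hk : vEdge k y₀ ∈ E) (h1 : vEdge 1 y₀ ∈ F) :
    IsCycleSet lattice (glueSet k y₀ E F) := by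
  refine hE.merge (hF.preimage (shiftIso k 0)) (fun p e he f hf hp hp' => ?_) hk ?_
    (adj_right k y₀) (adj_right k (y₀ + 1)) (by simp)
  · have a := bE e he p hp
    have b := bF.shift hf hp'
    omega
  · exact vEdge_mem_shift.2 (by simpa using h1)

theorem inBox_glueSet (bE : InBox k n E) (bF : InBox m n F) (hm : 1 ≤ m) (hk : vEdge k y₀ ∈ E) :
    InBox (k + m) n (glueSet k y₀ E F) := by
  have hk' := bE.vEdge hk
  refine (((bE.mono (by omega) le_rfl).subset Set.sdiff_subset).union (InBox.union ?_
    (InBox.subset (E := shift k 0 F) ?_ Set.sdiff_subset)))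
  · rintro e (rfl | rfl) p hp <;> rcases Sym2.mem_iff.1 hp with rfl | rfl <;> simp only <;> omega
  · intro e he p hp
    have := bF.shift he hp
    omega

theorem vEdge_mem_glueSet_left (bF : InBox m n F) {x y : ℤ} (hx : x < k) :
    vEdge x y ∈ glueSet k y₀ E F ↔ vEdge x y ∈ E := by
  rw [vEdge_mem_glueSet]
  have := fun h => bF.vEdge (x := x - k) (y := y) h
  constructor
  · rintro (h | h)
    · exact h.1
    · have := this h.1; omega
  · exact fun h => .inl ⟨h, by omega⟩

theorem vEdge_mem_glueSet_right (bE : InBox k n E) {x y : ℤ} (hx : k + 1 < x) :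
    vEdge x y ∈ glueSet k y₀ E F ↔ vEdge (x - k) y ∈ F := by
  rw [vEdge_mem_glueSet]
  constructor
  · rintro (h | h)
    · have := bE.vEdge h.1; omega
    · exact h.1
  · exact fun h => .inr ⟨h, by omega⟩

theorem hEdge_mem_glueSet_left (bF : InBox m n F) {x y : ℤ} (hx : x < k) :
    hEdge x y ∈ glueSet k y₀ E F ↔ hEdge x y ∈ E := by
  rw [hEdge_mem_glueSet]
  constructor
  · rintro (h | h | h)
    · exact h
    · omega
    · have := bF.hEdge h; omega
  · exact .inl

theorem hEdge_mem_glueSet_right (bE : InBox k n E) {x y : ℤ} (hx : k < x) :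
    hEdge x y ∈ glueSet k y₀ E F ↔ hEdge (x - k) y ∈ F := by
  rw [hEdge_mem_glueSet]
  constructor
  · rintro (h | h | h)
    · have := bE.hEdge h; omega
    · omega
    · exact h
  · exact fun h => .inr (.inr h)

end Glue

namespace Ambiguous

variable {k m n : ℤ} {E₁ E₂ F₁ F₂ : Set (Sym2 (ℤ × ℤ))}

theorem mirror (h : Ambiguous m n E₁ E₂) : Ambiguous m n (mirror m E₂) (mirror m E₁) where
  cycle₁ := h.cycle₂.preimage _
  cycle₂ := h.cycle₁.preimage _
  box₁ := h.box₂.mirror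
  box₂ := h.box₁.mirror
  ne := by
    obtain ⟨x, y, hxy | hxy⟩ := h.ne
    · refine ⟨m - x, y, .inl ?_⟩
      rwa [dif_hEdge_mirror, sub_sub_cancel, neg_ne_zero]
    · refine ⟨m + 1 - x, y, .inr ?_⟩
      rwa [dif_vEdge_mirror, sub_sub_cancel, neg_ne_zero]
  sig x y h1 h2 h3 h4 := by
    have := h.sig (m - x) y (by omega) (by omega) h3 h4
    rw [dif_hEdge_mirror, dif_hEdge_mirror, dif_vEdge_mirror, dif_vEdge_mirror,
      show m + 1 - (x + 1) = m - x by ring, show m + 1 - x = m - x + 1 by ring]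
    linarith

theorem transpose (h : Ambiguous m n E₁ E₂) :
    Ambiguous n m (transpose E₁) (transpose E₂) where
  cycle₁ := h.cycle₁.preimage _
  cycle₂ := h.cycle₂.preimage _
  box₁ := h.box₁.transpose
  box₂ := h.box₂.transpose
  ne := by
    obtain ⟨x, y, hxy⟩ := h.ne
    exact ⟨y, x, hxy.symm⟩
  sig x y h1 h2 h3 h4 := by
    have := h.sig y x h3 h4 h1 h2
    have a : ∀ x y, dif (Slitherlink.transpose E₁) (Slitherlink.transpose E₂) (hEdge x y) =
      dif E₁ E₂ (vEdge y x) := fun _ _ => rfl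
    have b : ∀ x y, dif (Slitherlink.transpose E₁) (Slitherlink.transpose E₂) (vEdge x y) =
      dif E₁ E₂ (hEdge y x) := fun _ _ => rfl
    rw [a, a, b, b]
    linarith

/-- Two ambiguous grids are merged along a common side. -/
theorem glue {y₀ : ℤ} (hE : Ambiguous k n E₁ E₂) (hF : Ambiguous m n F₁ F₂) (hm : 1 ≤ m)
    (hc : ∀ y, dif E₁ E₂ (vEdge k y) + dif F₁ F₂ (vEdge 1 y) = 0)
    (hE₁ : vEdge k y₀ ∈ E₁) (hE₂ : vEdge k y₀ ∈ E₂) (hF₁ : vEdge 1 y₀ ∈ F₁)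
    (hF₂ : vEdge 1 y₀ ∈ F₂) :
    Ambiguous (k + m) n (glueSet k y₀ E₁ F₁) (glueSet k y₀ E₂ F₂) := by
  have hvl : ∀ x y, x ≤ k → dif (glueSet k y₀ E₁ F₁) (glueSet k y₀ E₂ F₂) (vEdge x y) =
      dif E₁ E₂ (vEdge x y) := by
    intro x y hx
    by_cases hxy : x = k ∧ y = y₀
    · obtain ⟨rfl, rfl⟩ := hxy
      rw [dif_eq_zero (iff_of_true hE₁ hE₂)]
      refine dif_eq_zero (iff_of_false ?_ ?_) <;> rw [vEdge_mem_glueSet] <;>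
        rintro (h | h)
      · exact h.2 ⟨rfl, rfl⟩
      · have := hF.box₁.vEdge h.1; omega
      · exact h.2 ⟨rfl, rfl⟩
      · have := hF.box₂.vEdge h.1; omega
    · have key : ∀ {E F}, InBox m n F → (vEdge x y ∈ glueSet k y₀ E F ↔ vEdge x y ∈ E) := by
        intro E F bF
        rw [vEdge_mem_glueSet]
        constructor
        · rintro (h | h)
          · exact h.1
          · have := bF.vEdge h.1; omega
        · exact fun h => .inl ⟨h, hxy⟩
      exact dif_congr (key hF.box₁) (key hF.box₂)
  have hvr : ∀ x y, k + 1 ≤ x → dif (glueSet k y₀ E₁ F₁) (glueSet k y₀ E₂ F₂) (vEdge x y) =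
      dif F₁ F₂ (vEdge (x - k) y) := by
    intro x y hx
    by_cases hxy : x = k + 1 ∧ y = y₀
    · obtain ⟨rfl, rfl⟩ := hxy
      rw [add_sub_cancel_left, dif_eq_zero (iff_of_true hF₁ hF₂)]
      refine dif_eq_zero (iff_of_false ?_ ?_) <;> rw [vEdge_mem_glueSet] <;>
        rintro (h | h)
      · have := hE.box₁.vEdge h.1; omega
      · exact h.2 ⟨rfl, rfl⟩
      · have := hE.box₂.vEdge h.1; omega
      · exact h.2 ⟨rfl, rfl⟩
    · have key : ∀ {E F}, InBox k n E → (vEdge x y ∈ glueSet k y₀ E F ↔ vEdge (x - k) y ∈ F) := by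
        intro E F bE
        rw [vEdge_mem_glueSet]
        constructor
        · rintro (h | h)
          · have := bE.vEdge h.1; omega
          · exact h.1
        · exact fun h => .inr ⟨h, hxy⟩
      exact dif_congr (key hE.box₁) (key hE.box₂)
  have hhl : ∀ x y, x < k → dif (glueSet k y₀ E₁ F₁) (glueSet k y₀ E₂ F₂) (hEdge x y) =
      dif E₁ E₂ (hEdge x y) := fun x y hx =>
    dif_congr (hEdge_mem_glueSet_left hF.box₁ hx) (hEdge_mem_glueSet_left hF.box₂ hx)
  have hhr : ∀ x y, k < x → dif (glueSet k y₀ E₁ F₁) (glueSet k y₀ E₂ F₂) (hEdge x y) =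
      dif F₁ F₂ (hEdge (x - k) y) := fun x y hx =>
    dif_congr (hEdge_mem_glueSet_right hE.box₁ hx) (hEdge_mem_glueSet_right hE.box₂ hx)
  have hhm : ∀ y, dif (glueSet k y₀ E₁ F₁) (glueSet k y₀ E₂ F₂) (hEdge k y) = 0 := by
    intro y
    have key : ∀ {E F}, InBox k n E → InBox m n F →
        (hEdge k y ∈ glueSet k y₀ E F ↔ (k = k ∧ y = y₀) ∨ (k = k ∧ y = y₀ + 1)) := by
      intro E F bE bF
      rw [hEdge_mem_glueSet]
      constructor
      · rintro (h | h | h)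
        · have := bE.hEdge h; omega
        · exact h
        · have := bF.hEdge h; omega
      · exact fun h => .inr (.inl h)
    exact dif_eq_zero ((key hE.box₁ hF.box₁).trans (key hE.box₂ hF.box₂).symm)
  refine ⟨isCycleSet_glueSet hE.cycle₁ hF.cycle₁ hE.box₁ hF.box₁ hE₁ hF₁,
    isCycleSet_glueSet hE.cycle₂ hF.cycle₂ hE.box₂ hF.box₂ hE₂ hF₂,
    inBox_glueSet hE.box₁ hF.box₁ hm hE₁, inBox_glueSet hE.box₂ hF.box₂ hm hE₂, ?_, ?_⟩
  · obtain ⟨x, y, hxy | hxy⟩ := hE.ne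
    · refine ⟨x, y, .inl ?_⟩
      rwa [hhl]
      by_contra hx
      exact hxy (dif_eq_zero (iff_of_false (fun h => hx (by have := hE.box₁.hEdge h; omega))
        (fun h => hx (by have := hE.box₂.hEdge h; omega))))
    · refine ⟨x, y, .inr ?_⟩
      rwa [hvl]
      by_contra hx
      exact hxy (dif_eq_zero (iff_of_false (fun h => hx (by have := hE.box₁.vEdge h; omega))
        (fun h => hx (by have := hE.box₂.vEdge h; omega))))
  · intro x y h1 h2 h3 h4
    rcases lt_trichotomy x k with hx | rfl | hx
    · rw [hhl _ _ hx, hhl _ _ hx, hvl _ _ (by omega), hvl _ _ (by omega)]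
      exact hE.sig x y h1 (by omega) h3 h4
    -- A seam cell has its left side in the first grid and its right side in the second. The
    -- horizontal seam edges are the same in both glued cycles, so only the border differences
    -- remain, and they cancel by `hc`.
    · rw [hhm, hhm, hvl _ _ le_rfl, hvr _ _ le_rfl, add_sub_cancel_left]
      have := hc y
      linarith
    · rw [hhr _ _ hx, hhr _ _ hx, hvr _ _ (by omega), hvr _ _ (by omega),
        show x + 1 - k = x - k + 1 by ring]
      exact hF.sig (x - k) y (by omega) (by omega) h3 h4

end Ambiguous

/-- The edges with left endpoint in the first `m - 1` columns and the left border agree. -/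
structure LeftAgree (m : ℤ) (S X : Set (Sym2 (ℤ × ℤ))) : Prop where
  vert : ∀ y, vEdge 1 y ∈ S ↔ vEdge 1 y ∈ X
  horiz : ∀ x y, x < m → (hEdge x y ∈ S ↔ hEdge x y ∈ X)

theorem leftAgree_glueSet {k m n y₀ : ℤ} {E F : Set (Sym2 (ℤ × ℤ))} (bF : InBox m n F)
    (hk : 2 ≤ k) : LeftAgree k (glueSet k y₀ E F) E :=
  ⟨fun _ => vEdge_mem_glueSet_left bF (by omega), fun _ _ hx => hEdge_mem_glueSet_left bF hx⟩

theorem LeftAgree.trans {m k : ℤ} {S T X : Set (Sym2 (ℤ × ℤ))} (h : LeftAgree k S T)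
    (h' : LeftAgree m T X) (hmk : m ≤ k) : LeftAgree m S X :=
  ⟨fun y => (h.vert y).trans (h'.vert y),
    fun x y hx => (h.horiz x y (by omega)).trans (h'.horiz x y hx)⟩

/-- Copies of an ambiguous grid and of its mirror image are joined in a row. -/
theorem Ambiguous.row {m n yL yR : ℤ} {X₁ X₂ : Set (Sym2 (ℤ × ℤ))} (hX : Ambiguous m n X₁ X₂)
    (hm : 2 ≤ m) (hL₁ : vEdge 1 yL ∈ X₁) (hL₂ : vEdge 1 yL ∈ X₂) (hR₁ : vEdge m yR ∈ X₁)
    (hR₂ : vEdge m yR ∈ X₂) (P : ℕ) (hP : 1 ≤ P) :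
    ∃ S₁ S₂, Ambiguous (P * m) n S₁ S₂ ∧ LeftAgree m S₁ X₁ ∧ LeftAgree m S₂ X₂ ∧
      ((∀ y, (vEdge (P * m) y ∈ S₁ ↔ vEdge m y ∈ X₁) ∧ (vEdge (P * m) y ∈ S₂ ↔ vEdge m y ∈ X₂)) ∨
      (∀ y, (vEdge (P * m) y ∈ S₁ ↔ vEdge 1 y ∈ X₂) ∧
        (vEdge (P * m) y ∈ S₂ ↔ vEdge 1 y ∈ X₁))) := by
  induction P, hP using Nat.le_induction with
  | base =>
    refine ⟨X₁, X₂, by simpa using hX, ⟨fun _ => Iff.rfl, fun _ _ _ => Iff.rfl⟩,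
      ⟨fun _ => Iff.rfl, fun _ _ _ => Iff.rfl⟩, .inl fun y => by simp⟩
  | succ P hP ih =>
    obtain ⟨S₁, S₂, hS, hl₁, hl₂, hr⟩ := ih
    have hPm : m ≤ P * m := le_mul_of_one_le_left (by omega) (by exact_mod_cast hP)
    have hcast : (((P + 1 : ℕ) : ℤ)) * m = P * m + m := by push_cast; ring
    rw [hcast]
    have hright : ∀ {y₀ E F y}, InBox (P * m) n E →
        (vEdge (P * m + m) y ∈ glueSet (P * m) y₀ E F ↔ vEdge m y ∈ F) := by
      intro y₀ E F y bE
      rw [vEdge_mem_glueSet_right bE (by omega), add_sub_cancel_left]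
    -- The copies alternate: if the right border is that of `X`, the exchanged mirror image is
    -- attached; if it is the exchanged left border of `X`, a plain copy is. Either way the
    -- differences across the seam are opposite.
    rcases hr with hr | hr
    · have hX' := hX.mirror
      have h1 : ∀ {E y}, vEdge 1 y ∈ Slitherlink.mirror m E ↔ vEdge m y ∈ E := by
        intro E y; rw [vEdge_mem_mirror, add_sub_cancel_right]
      have h2 : ∀ {E y}, vEdge m y ∈ Slitherlink.mirror m E ↔ vEdge 1 y ∈ E := by
        intro E y; rw [vEdge_mem_mirror, add_sub_cancel_left]
      refine ⟨_, _, hS.glue (y₀ := yR) hX' (by omega) (fun y => ?_) ((hr _).1.2 hR₁)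
        ((hr _).2.2 hR₂) (h1.2 hR₂) (h1.2 hR₁), ?_, ?_, .inr fun y => ⟨?_, ?_⟩⟩
      · rw [dif_congr (hr y).1 (hr y).2, dif_congr h1 h1, dif_swap X₁ X₂, add_neg_cancel]
      · exact (leftAgree_glueSet hX'.box₁ (by omega)).trans hl₁ hPm
      · exact (leftAgree_glueSet hX'.box₂ (by omega)).trans hl₂ hPm
      · rw [hright hS.box₁, h2]
      · rw [hright hS.box₂, h2]
    · refine ⟨_, _, hS.glue (y₀ := yL) hX (by omega) (fun y => ?_) ((hr _).1.2 hL₂)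
        ((hr _).2.2 hL₁) hL₁ hL₂, ?_, ?_, .inl fun y => ⟨?_, ?_⟩⟩
      · rw [dif_congr (hr y).1 (hr y).2, dif_swap X₁ X₂, neg_add_cancel]
      · exact (leftAgree_glueSet hX.box₁ (by omega)).trans hl₁ hPm
      · exact (leftAgree_glueSet hX.box₂ (by omega)).trans hl₂ hPm
      · rw [hright hS.box₁]
      · rw [hright hS.box₂]

/-- An ambiguous grid whose two cycles share an edge on each side yields ambiguous grids whose
dimensions are multiples of the given ones. -/
theorem Ambiguous.tile {m n yL yR xB xT : ℤ} {X₁ X₂ : Set (Sym2 (ℤ × ℤ))}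
    (hX : Ambiguous m n X₁ X₂) (hm : 2 ≤ m) (hn : 2 ≤ n)
    (hL₁ : vEdge 1 yL ∈ X₁) (hL₂ : vEdge 1 yL ∈ X₂) (hR₁ : vEdge m yR ∈ X₁)
    (hR₂ : vEdge m yR ∈ X₂) (hB₁ : hEdge xB 1 ∈ X₁) (hB₂ : hEdge xB 1 ∈ X₂)
    (hT₁ : hEdge xT n ∈ X₁) (hT₂ : hEdge xT n ∈ X₂) {P Q : ℕ} (hP : 1 ≤ P) (hQ : 1 ≤ Q) :
    ∃ S₁ S₂, Ambiguous (P * m) (Q * n) S₁ S₂ := by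
  obtain ⟨S₁, S₂, hS, hl₁, hl₂, -⟩ := hX.row hm hL₁ hL₂ hR₁ hR₂ P hP
  have hB := hX.box₁.hEdge hB₁
  have hT := hX.box₁.hEdge hT₁
  -- The seams do not touch the horizontal edges of the first copy, so the common bottom and top
  -- edges of `X` survive and serve as seams in the other direction.
  obtain ⟨T₁, T₂, hT, -⟩ := hS.transpose.row (yL := xB) (yR := xT) hn
    (vEdge_mem_transpose.2 ((hl₁.horiz _ _ (by omega)).2 hB₁))
    (vEdge_mem_transpose.2 ((hl₂.horiz _ _ (by omega)).2 hB₂))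
    (vEdge_mem_transpose.2 ((hl₁.horiz _ _ (by omega)).2 hT₁))
    (vEdge_mem_transpose.2 ((hl₂.horiz _ _ (by omega)).2 hT₂)) Q hQ
  exact ⟨_, _, hT.transpose⟩

end Slitherlink

/-! ### Cycles given by lists of points, and the small examples -/

namespace Slitherlink

open SimpleGraph

instance : DecidableRel lattice.Adj := fun p q => by
  unfold lattice
  dsimp only
  infer_instance

/-- The edges between consecutive points of a list. -/
def listEdges : List (ℤ × ℤ) → List (Sym2 (ℤ × ℤ))
  | a :: b :: l => s(a, b) :: listEdges (b :: l)
  | _ => []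

/-- The edges of the closed walk through the points of the list `a :: l`. -/
def loopEdges (a : ℤ × ℤ) (l : List (ℤ × ℤ)) : List (Sym2 (ℤ × ℤ)) :=
  s(l.getLastD a, a) :: listEdges (a :: l)

theorem isPathSet_listEdges {a : ℤ × ℤ} {l : List (ℤ × ℤ)} (hc : (a :: l).IsChain lattice.Adj)
    (hn : (a :: l).Nodup) :
    IsPathSet lattice a (l.getLastD a) {e | e ∈ listEdges (a :: l)} := by
  have key : ∀ (l : List (ℤ × ℤ)) (a : ℤ × ℤ), (a :: l).IsChain lattice.Adj →
      ∃ p : lattice.Walk a (l.getLastD a), p.support = a :: l ∧ p.edges = listEdges (a :: l) := by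
    intro l
    induction l with
    | nil => exact fun a _ => ⟨.nil, rfl, rfl⟩
    | cons b l ih =>
      intro a h
      rw [List.isChain_cons_cons] at h
      obtain ⟨p, h1, h2⟩ := ih b h.2
      rw [List.getLastD_cons]
      exact ⟨.cons h.1 p, by rw [Walk.support_cons, h1],
        by rw [Walk.edges_cons, h2]; rfl⟩
  obtain ⟨p, h1, h2⟩ := key l a hc
  refine ⟨p, by rw [Walk.isPath_def, h1]; exact hn, ?_⟩
  ext e
  change e ∈ p.edges ↔ _
  rw [h2]; rfl

theorem isCycleSet_loopEdges {a : ℤ × ℤ} {l : List (ℤ × ℤ)}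
    (h : (a :: l).IsChain lattice.Adj ∧ (a :: l).Nodup ∧ lattice.Adj (l.getLastD a) a ∧
      s(l.getLastD a, a) ∉ listEdges (a :: l)) :
    IsCycleSet lattice {e | e ∈ loopEdges a l} := by
  obtain ⟨hc, hn, hadj, hl⟩ := h
  convert (isPathSet_listEdges hc hn).close hadj hl using 1
  ext e
  simp only [loopEdges, List.mem_cons, Set.mem_ofPred_eq, Set.mem_insert_iff]

theorem mem_of_mem_listEdges {l : List (ℤ × ℤ)} {e : Sym2 (ℤ × ℤ)} (he : e ∈ listEdges l)
    {p : ℤ × ℤ} (hp : p ∈ e) : p ∈ l := by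
  induction l with
  | nil => simp [listEdges] at he
  | cons a l ih =>
    cases l with
    | nil => simp [listEdges] at he
    | cons b l =>
      rw [listEdges, List.mem_cons] at he
      rcases he with rfl | he
      · rcases Sym2.mem_iff.1 hp with rfl | rfl <;> simp
      · exact List.mem_cons_of_mem _ (ih he)

theorem mem_of_mem_loopEdges {a : ℤ × ℤ} {l : List (ℤ × ℤ)} {e : Sym2 (ℤ × ℤ)}
    (he : e ∈ loopEdges a l) {p : ℤ × ℤ} (hp : p ∈ e) : p ∈ a :: l := by
  rw [loopEdges, List.mem_cons] at he
  rcases he with rfl | he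
  · rcases Sym2.mem_iff.1 hp with rfl | rfl
    · exact List.getLastD_mem_cons
    · simp
  · exact mem_of_mem_listEdges he hp

theorem inBox_loopEdges {m n : ℤ} {a : ℤ × ℤ} {l : List (ℤ × ℤ)}
    (h : ∀ p ∈ a :: l, 1 ≤ p.1 ∧ p.1 ≤ m ∧ 1 ≤ p.2 ∧ p.2 ≤ n) :
    InBox m n {e | e ∈ loopEdges a l} :=
  fun _ he _ hp => h _ (mem_of_mem_loopEdges he hp)

theorem dif_list (L₁ L₂ : List (Sym2 (ℤ × ℤ))) (e : Sym2 (ℤ × ℤ)) :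
    dif {e | e ∈ L₁} {e | e ∈ L₂} e = (if e ∈ L₁ then 1 else 0) - (if e ∈ L₂ then 1 else 0) := by
  have key : ∀ L : List (Sym2 (ℤ × ℤ)), (ind {e | e ∈ L} e : ℤ) = if e ∈ L then 1 else 0 := by
    intro L
    by_cases h : e ∈ L
    · rw [if_pos h, ind_of_mem (show e ∈ {e | e ∈ L} from h), Nat.cast_one]
    · rw [if_neg h, ind_of_notMem (show e ∉ {e | e ∈ L} from h), Nat.cast_zero]
  rw [dif, key, key]

/-- The points on the first cycle of an ambiguous `4 × 4` grid, after its starting point. -/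
def four₁ : List (ℤ × ℤ) :=
  [(2, 1), (3, 1), (3, 2), (4, 2), (4, 3), (4, 4), (3, 4), (2, 4), (2, 3), (1, 3), (1, 2)]

/-- The points on the second cycle of an ambiguous `4 × 4` grid. -/
def four₂ : List (ℤ × ℤ) :=
  [(3, 1), (2, 1), (2, 2), (1, 2), (1, 3), (1, 4), (2, 4), (3, 4), (3, 3), (4, 3), (4, 2)]

/-- The points on the first cycle of an ambiguous `6 × 4` grid. -/
def six₁ : List (ℤ × ℤ) :=
  [(1, 2), (1, 3), (2, 3), (2, 4), (3, 4), (4, 4), (5, 4), (5, 3), (6, 3), (6, 2), (6, 1), (5, 1),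
    (4, 1), (4, 2), (4, 3), (3, 3), (3, 2), (3, 1), (2, 1)]

/-- The points on the second cycle of an ambiguous `6 × 4` grid. -/
def six₂ : List (ℤ × ℤ) :=
  [(1, 3), (1, 4), (2, 4), (3, 4), (3, 3), (3, 2), (4, 2), (4, 3), (4, 4), (5, 4), (6, 4), (6, 3),
    (6, 2), (5, 2), (5, 1), (4, 1), (3, 1), (2, 1), (2, 2)]

/-- The points on the first cycle of an ambiguous `3 × 3` grid. -/
def three₁ : List (ℤ × ℤ) := [(2, 1), (3, 1), (3, 2), (2, 2), (2, 3), (1, 3), (1, 2)]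

/-- The points on the second cycle of an ambiguous `3 × 3` grid. -/
def three₂ : List (ℤ × ℤ) := [(2, 1), (3, 1), (3, 2), (3, 3), (2, 3), (1, 3), (1, 2)]

theorem ambiguous_loopEdges {m n : ℤ} {a b : ℤ × ℤ} {l₁ l₂ : List (ℤ × ℤ)}
    (h₁ : (a :: l₁).IsChain lattice.Adj ∧ (a :: l₁).Nodup ∧ lattice.Adj (l₁.getLastD a) a ∧
      s(l₁.getLastD a, a) ∉ listEdges (a :: l₁))
    (h₂ : (b :: l₂).IsChain lattice.Adj ∧ (b :: l₂).Nodup ∧ lattice.Adj (l₂.getLastD b) b ∧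
      s(l₂.getLastD b, b) ∉ listEdges (b :: l₂))
    (hb₁ : ∀ p ∈ a :: l₁, 1 ≤ p.1 ∧ p.1 ≤ m ∧ 1 ≤ p.2 ∧ p.2 ≤ n)
    (hb₂ : ∀ p ∈ b :: l₂, 1 ≤ p.1 ∧ p.1 ≤ m ∧ 1 ≤ p.2 ∧ p.2 ≤ n)
    (hne : hEdge 1 1 ∈ loopEdges a l₁ ∧ hEdge 1 1 ∉ loopEdges b l₂)
    (hs : ∀ x ∈ Finset.Ico 1 m, ∀ y ∈ Finset.Ico 1 n,
      ((((if hEdge x y ∈ loopEdges a l₁ then 1 else 0) -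
        (if hEdge x y ∈ loopEdges b l₂ then 1 else 0)) +
      ((if hEdge x (y + 1) ∈ loopEdges a l₁ then 1 else 0) -
        (if hEdge x (y + 1) ∈ loopEdges b l₂ then 1 else 0)) +
      ((if vEdge x y ∈ loopEdges a l₁ then 1 else 0) -
        (if vEdge x y ∈ loopEdges b l₂ then 1 else 0)) +
      ((if vEdge (x + 1) y ∈ loopEdges a l₁ then 1 else 0) -
        (if vEdge (x + 1) y ∈ loopEdges b l₂ then 1 else 0)) : ℤ)) = 0) :
    Ambiguous m n {e | e ∈ loopEdges a l₁} {e | e ∈ loopEdges b l₂} where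
  cycle₁ := isCycleSet_loopEdges h₁
  cycle₂ := isCycleSet_loopEdges h₂
  box₁ := inBox_loopEdges hb₁
  box₂ := inBox_loopEdges hb₂
  ne := ⟨1, 1, .inl (by rw [dif_list, if_pos hne.1, if_neg hne.2]; decide)⟩
  sig x y hx hx' hy hy' := by
    rw [dif_list, dif_list, dif_list, dif_list]
    exact hs x (Finset.mem_Ico.2 ⟨hx, by omega⟩) y (Finset.mem_Ico.2 ⟨hy, by omega⟩)

theorem ambiguous_four : Ambiguous 4 4 {e | e ∈ loopEdges (1, 1) four₁}
    {e | e ∈ loopEdges (4, 1) four₂} :=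
  ambiguous_loopEdges (by decide +kernel) (by decide +kernel) (by decide +kernel)
    (by decide +kernel) (by decide +kernel) (by decide +kernel)

theorem ambiguous_six : Ambiguous 6 4 {e | e ∈ loopEdges (1, 1) six₁}
    {e | e ∈ loopEdges (1, 2) six₂} :=
  ambiguous_loopEdges (by decide +kernel) (by decide +kernel) (by decide +kernel)
    (by decide +kernel) (by decide +kernel) (by decide +kernel)

end Slitherlink

/-! ### Even dimensions with one of them divisible by four -/

namespace Slitherlink

open SimpleGraph

theorem Ambiguous.symm {m n : ℤ} {E₁ E₂ : Set (Sym2 (ℤ × ℤ))} (h : Ambiguous m n E₁ E₂) :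
    Ambiguous m n E₂ E₁ where
  cycle₁ := h.cycle₂
  cycle₂ := h.cycle₁
  box₁ := h.box₂
  box₂ := h.box₁
  ne := by
    obtain ⟨x, y, hxy⟩ := h.ne
    exact ⟨x, y, by rwa [dif_swap, dif_swap E₁, neg_ne_zero, neg_ne_zero]⟩
  sig x y h1 h2 h3 h4 := by
    have := h.sig x y h1 h2 h3 h4
    rw [dif_swap E₁, dif_swap E₁, dif_swap E₁, dif_swap E₁]
    linarith

theorem exists_ambiguous_mul_four {P Q : ℕ} (hP : 1 ≤ P) (hQ : 1 ≤ Q) :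
    ∃ S₁ S₂, Ambiguous (P * 4) (Q * 4) S₁ S₂ :=
  ambiguous_four.tile (yL := 2) (yR := 2) (xB := 2) (xT := 2) (by decide) (by decide)
    (by decide +kernel : vEdge 1 2 ∈ loopEdges _ _) (by decide +kernel : vEdge 1 2 ∈ loopEdges _ _)
    (by decide +kernel : vEdge 4 2 ∈ loopEdges _ _) (by decide +kernel : vEdge 4 2 ∈ loopEdges _ _)
    (by decide +kernel : hEdge 2 1 ∈ loopEdges _ _) (by decide +kernel : hEdge 2 1 ∈ loopEdges _ _)
    (by decide +kernel : hEdge 2 4 ∈ loopEdges _ _) (by decide +kernel : hEdge 2 4 ∈ loopEdges _ _)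
    hP hQ

/-- An ambiguous `k × 4` grid whose two cycles share the second edge of its lower and upper side
yields ambiguous grids of width `k` and height divisible by four. -/
theorem Ambiguous.stack {k : ℤ} {X₁ X₂ : Set (Sym2 (ℤ × ℤ))} (h : Ambiguous k 4 X₁ X₂)
    (hB₁ : hEdge 2 1 ∈ X₁) (hB₂ : hEdge 2 1 ∈ X₂) (hT₁ : hEdge 2 4 ∈ X₁) (hT₂ : hEdge 2 4 ∈ X₂)
    {P : ℕ} (hP : 1 ≤ P) : ∃ S₁ S₂, Ambiguous (P * 4) k S₁ S₂ := by
  obtain ⟨S₁, S₂, hS, -⟩ := h.transpose.row (yL := 2) (yR := 2) (by decide) hB₁ hB₂ hT₁ hT₂ P hP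
  exact ⟨S₁, S₂, hS⟩

theorem exists_ambiguous_four_six {P : ℕ} (hP : 1 ≤ P) (b : ℕ) :
    ∃ S₁ S₂, Ambiguous (P * 4) (6 + b * 4) S₁ S₂ := by
  have B₁ : hEdge 2 1 ∈ {e | e ∈ loopEdges (1, 1) six₁} :=
    (by decide +kernel : hEdge 2 1 ∈ loopEdges _ _)
  have B₂ : hEdge 2 1 ∈ {e | e ∈ loopEdges (1, 2) six₂} :=
    (by decide +kernel : hEdge 2 1 ∈ loopEdges _ _)
  have T₁ : hEdge 2 4 ∈ {e | e ∈ loopEdges (1, 1) six₁} :=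
    (by decide +kernel : hEdge 2 4 ∈ loopEdges _ _)
  have T₂ : hEdge 2 4 ∈ {e | e ∈ loopEdges (1, 2) six₂} :=
    (by decide +kernel : hEdge 2 4 ∈ loopEdges _ _)
  rcases Nat.eq_zero_or_pos b with rfl | hb
  · simpa using ambiguous_six.stack B₁ B₂ T₁ T₂ hP
  have L₁ : vEdge 1 2 ∈ {e | e ∈ loopEdges (1, 1) four₁} :=
    (by decide +kernel : vEdge 1 2 ∈ loopEdges _ _)
  have L₂ : vEdge 1 2 ∈ {e | e ∈ loopEdges (4, 1) four₂} :=
    (by decide +kernel : vEdge 1 2 ∈ loopEdges _ _)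
  -- The right border of the `6 × 4` pair has the same differences as the left border of the `4 × 4`
  -- pair, so the two cycles of the latter are exchanged to make them cancel.
  obtain ⟨S₁, S₂, hS, hl₁, hl₂, -⟩ := ambiguous_four.symm.row (yL := 2) (yR := 2) (by decide)
    L₂ L₁ (by decide +kernel : vEdge 4 2 ∈ loopEdges _ _)
    (by decide +kernel : vEdge 4 2 ∈ loopEdges _ _) b hb
  have hglue := ambiguous_six.glue (y₀ := 2) hS (by omega) (fun y => ?_)
    (by decide +kernel : vEdge 6 2 ∈ loopEdges _ _)
    (by decide +kernel : vEdge 6 2 ∈ loopEdges _ _) ((hl₁.vert 2).2 L₂) ((hl₂.vert 2).2 L₁)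
  · exact hglue.stack ((hEdge_mem_glueSet_left hS.box₁ (by decide)).2 B₁)
      ((hEdge_mem_glueSet_left hS.box₂ (by decide)).2 B₂)
      ((hEdge_mem_glueSet_left hS.box₁ (by decide)).2 T₁)
      ((hEdge_mem_glueSet_left hS.box₂ (by decide)).2 T₂) hP
  · rw [dif_congr (hl₁.vert y) (hl₂.vert y)]
    by_cases hy : 1 ≤ y ∧ y ≤ 3
    · obtain ⟨h1, h3⟩ := hy
      rw [dif_list, dif_list]
      interval_cases y <;> decide +kernel
    · rw [dif_eq_zero, dif_eq_zero, add_zero]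
      · exact iff_of_false (fun h => hy (by have := ambiguous_four.box₂.vEdge h; omega))
          (fun h => hy (by have := ambiguous_four.box₁.vEdge h; omega))
      · exact iff_of_false (fun h => hy (by have := ambiguous_six.box₁.vEdge h; omega))
          (fun h => hy (by have := ambiguous_six.box₂.vEdge h; omega))

theorem exists_ambiguous_of_even {m n : ℕ} (hm : 3 ≤ m) (hn : 3 ≤ n) (hm4 : m % 4 = 0)
    (hn2 : n % 2 = 0) : ∃ S₁ S₂, Ambiguous m n S₁ S₂ := by
  by_cases hn4 : n % 4 = 0
  · have := exists_ambiguous_mul_four (P := m / 4) (Q := n / 4) (by omega) (by omega)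
    rwa [show ((m / 4 : ℕ) : ℤ) * 4 = m by omega, show ((n / 4 : ℕ) : ℤ) * 4 = n by omega] at this
  -- Here `n` is `2` modulo 4 and at least 3, hence at least 6.
  · have := exists_ambiguous_four_six (P := m / 4) (by omega) ((n - 6) / 4)
    rwa [show ((m / 4 : ℕ) : ℤ) * 4 = m by omega,
      show 6 + (((n - 6) / 4 : ℕ) : ℤ) * 4 = n by omega] at this

/-! ### Diagonal pairs in odd squares -/

/-- The indicator function of the left and lower edges of the diagonal cells minus that of their
right and upper edges, on horizontal edges. -/
def diagH (e x y : ℤ) : ℤ :=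
  (if x = y ∧ 1 ≤ x ∧ x < e then 1 else 0) - (if y = x + 1 ∧ 1 ≤ x ∧ x < e then 1 else 0)

/-- The edge sets of two cycles in the `e × e` grid which differ along the diagonal cells. -/
structure DiagonalPair (e : ℤ) (E₁ E₂ : Set (Sym2 (ℤ × ℤ))) : Prop where
  cycle₁ : IsCycleSet lattice E₁
  cycle₂ : IsCycleSet lattice E₂
  box₁ : InBox e e E₁
  box₂ : InBox e e E₂
  corner : ∀ f ∈ E₁, (e, e) ∉ f
  horiz : ∀ x y, dif E₁ E₂ (hEdge x y) = diagH e x y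
  vert : ∀ x y, dif E₁ E₂ (vEdge x y) = diagH e y x
  left : vEdge 1 2 ∈ E₁ ∧ vEdge 1 2 ∈ E₂
  bottom : hEdge 2 1 ∈ E₁ ∧ hEdge 2 1 ∈ E₂
  right : vEdge e (e - 2) ∈ E₁ ∧ vEdge e (e - 2) ∈ E₂
  top : hEdge (e - 2) e ∈ E₁ ∧ hEdge (e - 2) e ∈ E₂

/-- In a diagonal cell, lower and left edges count `+1`, upper and right ones `-1`. A cell next to
the diagonal shares one edge of each sign with the two diagonal cells it touches, and all other
cells see no difference. -/
theorem DiagonalPair.ambiguous {e : ℤ} {E₁ E₂ : Set (Sym2 (ℤ × ℤ))} (h : DiagonalPair e E₁ E₂)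
    (he : 2 ≤ e) : Ambiguous e e E₁ E₂ where
  cycle₁ := h.cycle₁
  cycle₂ := h.cycle₂
  box₁ := h.box₁
  box₂ := h.box₂
  ne := ⟨1, 1, .inl (by rw [h.horiz, diagH, if_pos (by omega), if_neg (by omega)]; decide)⟩
  sig x y h1 h2 h3 h4 := by
    rw [h.horiz, h.horiz, h.vert, h.vert]
    simp only [diagH]
    split_ifs <;> omega

theorem diagonalPair_three : DiagonalPair 3 {e | e ∈ loopEdges (1, 1) three₁}
    {e | e ∈ loopEdges (2, 2) three₂} := by
  have b₁ : InBox 3 3 {e | e ∈ loopEdges (1, 1) three₁} := inBox_loopEdges (by decide +kernel)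
  have b₂ : InBox 3 3 {e | e ∈ loopEdges (2, 2) three₂} := inBox_loopEdges (by decide +kernel)
  refine ⟨isCycleSet_loopEdges (by decide +kernel), isCycleSet_loopEdges (by decide +kernel),
    b₁, b₂, fun f hf hp => ?_, fun x y => ?_, fun x y => ?_,
    ⟨(by decide +kernel : vEdge 1 2 ∈ loopEdges _ _),
      (by decide +kernel : vEdge 1 2 ∈ loopEdges _ _)⟩,
    ⟨(by decide +kernel : hEdge 2 1 ∈ loopEdges _ _),
      (by decide +kernel : hEdge 2 1 ∈ loopEdges _ _)⟩,
    ⟨(by decide +kernel : vEdge 3 (3 - 2) ∈ loopEdges _ _),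
      (by decide +kernel : vEdge 3 (3 - 2) ∈ loopEdges _ _)⟩,
    ⟨(by decide +kernel : hEdge (3 - 2) 3 ∈ loopEdges _ _),
      (by decide +kernel : hEdge (3 - 2) 3 ∈ loopEdges _ _)⟩⟩
  · exact absurd (mem_of_mem_loopEdges hf hp) (by decide +kernel)
  · by_cases h : (1 ≤ x ∧ x ≤ 2) ∧ 1 ≤ y ∧ y ≤ 3
    · obtain ⟨⟨h1, h2⟩, h3, h4⟩ := h
      rw [dif_list]
      interval_cases x <;> interval_cases y <;> decide +kernel
    · rw [dif_eq_zero (iff_of_false (fun h' => h (by have := b₁.hEdge h'; omega))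
          (fun h' => h (by have := b₂.hEdge h'; omega))), diagH, if_neg (by omega),
        if_neg (by omega), sub_zero]
  · by_cases h : (1 ≤ x ∧ x ≤ 3) ∧ 1 ≤ y ∧ y ≤ 2
    · obtain ⟨⟨h1, h2⟩, h3, h4⟩ := h
      rw [dif_list]
      interval_cases x <;> interval_cases y <;> decide +kernel
    · rw [dif_eq_zero (iff_of_false (fun h' => h (by have := b₁.vEdge h'; omega))
          (fun h' => h (by have := b₂.vEdge h'; omega))), diagH, if_neg (by omega),
        if_neg (by omega), sub_zero]

end Slitherlink

/-! ### Extending a diagonal pair by a `3 × 3` block -/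

namespace Slitherlink

open SimpleGraph

/-- The edge `vEdge x y` replaced by the other three edges of the square on its right. -/
def bumpSet (x y : ℤ) (E : Set (Sym2 (ℤ × ℤ))) : Set (Sym2 (ℤ × ℤ)) :=
  (E \ {vEdge x y}) ∪ {hEdge x y, vEdge (x + 1) y, hEdge x (y + 1)}

/-- Two sets of edges merged along the square with lower left vertex `(x, y)`. -/
def stackSet (x y : ℤ) (E F : Set (Sym2 (ℤ × ℤ))) : Set (Sym2 (ℤ × ℤ)) :=
  (E \ {hEdge x y}) ∪ ({vEdge x y, vEdge (x + 1) y} ∪ (F \ {hEdge x (y + 1)}))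

section Bump

variable {m n x y : ℤ} {E : Set (Sym2 (ℤ × ℤ))}

theorem isCycleSet_bumpSet (hE : IsCycleSet lattice E) (bE : InBox m n E) (h : vEdge m y ∈ E) :
    IsCycleSet lattice (bumpSet m y E) :=
  hE.detour (c := (m + 1, y)) (d := (m + 1, y + 1)) h (adj_right _ _) (adj_up _ _)
    (adj_right _ _) (by simp)
    (fun e he hp => by have := bE e he _ hp; simp only at this; omega)
    (fun e he hp => by have := bE e he _ hp; simp only at this; omega)

theorem inBox_bumpSet (bE : InBox m n E) (h : vEdge m y ∈ E) :
    InBox (m + 1) n (bumpSet m y E) := by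
  have hb := bE.vEdge h
  refine ((bE.mono (by omega) le_rfl).subset Set.sdiff_subset).union ?_
  rintro e (rfl | rfl | rfl) p hp <;> rcases Sym2.mem_iff.1 hp with rfl | rfl <;> simp only <;>
    omega

theorem vertex_of_mem_bumpSet {e : Sym2 (ℤ × ℤ)} (he : e ∈ bumpSet x y E) {p : ℤ × ℤ}
    (hp : p ∈ e) : (∃ f ∈ E, p ∈ f) ∨ p.2 ≤ y + 1 := by
  rcases he with he | rfl | rfl | rfl
  · exact .inl ⟨e, he.1, hp⟩
  all_goals
    right
    rcases Sym2.mem_iff.1 hp with rfl | rfl <;> simp only <;> omega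

end Bump

/-- The edges of a cycle in the `(k + 2) × (k + 2)` grid together with those of a cycle in a
`3 × 3` grid whose lower left vertex is `(k + 2, k + 2)`, joined below the latter. -/
def extendSet (k : ℤ) (E T : Set (Sym2 (ℤ × ℤ))) : Set (Sym2 (ℤ × ℤ)) :=
  stackSet (k + 2 + 1) (k + 1) (bumpSet (k + 2 + 1) k (bumpSet (k + 2) k E))
    (shift (k + 1) (k + 1) T)

section Extend

variable {k x y : ℤ} {E T : Set (Sym2 (ℤ × ℤ))}

theorem hEdge_mem_extendSet (bE : InBox (k + 2) (k + 2) E) : hEdge x y ∈ extendSet k E T ↔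
    hEdge x y ∈ E ∨ (x = k + 2 ∧ (y = k ∨ y = k + 1)) ∨ (x = k + 3 ∧ y = k) ∨
      (hEdge (x - (k + 1)) (y - (k + 1)) ∈ T ∧ ¬(x = k + 3 ∧ y = k + 2)) := by
  have hb := fun h => bE.hEdge (x := x) (y := y) h
  simp only [extendSet, stackSet, bumpSet, Set.mem_union, Set.mem_sdiff, Set.mem_singleton_iff,
    Set.mem_insert_iff, hEdge_inj, hEdge_ne_vEdge, hEdge_mem_shift]
  grind

theorem vEdge_mem_extendSet (bE : InBox (k + 2) (k + 2) E) : vEdge x y ∈ extendSet k E T ↔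
    (vEdge x y ∈ E ∧ ¬(x = k + 2 ∧ y = k)) ∨ (x = k + 4 ∧ (y = k ∨ y = k + 1)) ∨
      (x = k + 3 ∧ y = k + 1) ∨ vEdge (x - (k + 1)) (y - (k + 1)) ∈ T := by
  have hb := fun h => bE.vEdge (x := x) (y := y) h
  simp only [extendSet, stackSet, bumpSet, Set.mem_union, Set.mem_sdiff, Set.mem_singleton_iff,
    Set.mem_insert_iff, vEdge_inj, vEdge_ne_hEdge, vEdge_mem_shift]
  grind

/-- Two detours push the edge `vEdge (k + 2) k` rightwards until the upper side of the second bump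
lies below the bottom edge of the new block; there the two cycles are merged. -/
theorem isCycleSet_extendSet (hE : IsCycleSet lattice E) (hT : IsCycleSet lattice T)
    (bE : InBox (k + 2) (k + 2) E) (bT : InBox 3 3 T) (hv : vEdge (k + 2) k ∈ E)
    (hh : hEdge 2 1 ∈ T) (hc : (∀ f ∈ E, (k + 2, k + 2) ∉ f) ∨ ∀ f ∈ T, (1, 1) ∉ f) :
    IsCycleSet lattice (extendSet k E T) := by
  have h1 := isCycleSet_bumpSet hE bE hv
  have b1 := inBox_bumpSet bE hv
  have hv1 : vEdge (k + 2 + 1) k ∈ bumpSet (k + 2) k E := .inr (.inr (.inl rfl))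
  have h2 := isCycleSet_bumpSet h1 b1 hv1
  refine h2.merge (hT.preimage (shiftIso (k + 1) (k + 1))) (fun p e he f hf hp hp' => ?_)
    (.inr (.inr (.inr rfl))) (hEdge_mem_shift.2 ?_) (adj_up _ _) (adj_up _ _) (by simp)
  · have hs := bT.shift hf hp'
    have : ∃ g ∈ E, p ∈ g := by
      rcases vertex_of_mem_bumpSet he hp with ⟨g, hg, hpg⟩ | h
      · rcases vertex_of_mem_bumpSet hg hpg with h | h
        · exact h
        · omega
      · omega
    obtain ⟨g, hg, hpg⟩ := this
    have hb := bE g hg p hpg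
    -- The old grid and the new block overlap only in this vertex, which `hc` keeps off one of the
    -- two cycles.
    have hpe : p = (k + 2, k + 2) := Prod.ext (by simp only; omega) (by simp only; omega)
    subst hpe
    rcases hc with hc | hc
    · exact hc g hg hpg
    · refine hc _ hf (Sym2.mem_map.2 ⟨_, hp', ?_⟩)
      simp [shiftIso]
  · convert hh using 2 <;> ring

theorem inBox_extendSet (bE : InBox (k + 2) (k + 2) E) (bT : InBox 3 3 T) (hk : 1 ≤ k)
    (hv : vEdge (k + 2) k ∈ E) : InBox (k + 2 + 2) (k + 2 + 2) (extendSet k E T) := by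
  have b1 := inBox_bumpSet bE hv
  have hv1 : vEdge (k + 2 + 1) k ∈ bumpSet (k + 2) k E := .inr (.inr (.inl rfl))
  have b2 := inBox_bumpSet b1 hv1
  refine ((b2.mono (by omega) (by omega)).subset Set.sdiff_subset).union (InBox.union ?_
    (InBox.subset (E := shift (k + 1) (k + 1) T) ?_ Set.sdiff_subset))
  · rintro e (rfl | rfl) p hp <;> rcases Sym2.mem_iff.1 hp with rfl | rfl <;> simp only <;> omega
  · intro e he p hp
    have := bT.shift he hp
    omega

theorem corner_notMem_extendSet (bE : InBox (k + 2) (k + 2) E) (hT : ∀ f ∈ T, (3, 3) ∉ f)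
    {f : Sym2 (ℤ × ℤ)} (hf : f ∈ extendSet k E T) : (k + 2 + 2, k + 2 + 2) ∉ f := by
  intro hp
  rcases hf with hf | hf | hf
  · have : (∃ g ∈ E, (k + 2 + 2, k + 2 + 2) ∈ g) := by
      rcases vertex_of_mem_bumpSet hf.1 hp with ⟨g, hg, hpg⟩ | h
      · rcases vertex_of_mem_bumpSet hg hpg with h | h
        · exact h
        · simp only at h; omega
      · simp only at h; omega
    obtain ⟨g, hg, hpg⟩ := this
    have := bE g hg _ hpg
    simp only at this
    omega
  · rcases hf with rfl | rfl <;> rcases Sym2.mem_iff.1 hp with h | h <;>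
      simp only [Prod.mk.injEq] at h <;> omega
  · refine hT _ hf.1 (Sym2.mem_map.2 ⟨_, hp, Prod.ext ?_ ?_⟩) <;>
      simp only [shiftIso, RelIso.coe_fn_mk, Equiv.coe_fn_mk] <;> ring

end Extend

/-- The overlapping corner is missed by `E₁` and by `T₂`, so both unions consist of disjoint cycles
before merging. The connection is identical in both, so the difference is that of the old diagonal
followed by that of the new block. -/
theorem DiagonalPair.extend {k : ℤ} (hk : 1 ≤ k) {E₁ E₂ T₁ T₂ : Set (Sym2 (ℤ × ℤ))}
    (hE : DiagonalPair (k + 2) E₁ E₂) (hT : DiagonalPair 3 T₁ T₂) (hT₂ : ∀ f ∈ T₂, (1, 1) ∉ f) :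
    DiagonalPair (k + 2 + 2) (extendSet k E₁ T₁) (extendSet k E₂ T₂) := by
  obtain ⟨r₁, r₂⟩ := hE.right
  rw [add_sub_cancel_right] at r₁ r₂
  refine ⟨isCycleSet_extendSet hE.cycle₁ hT.cycle₁ hE.box₁ hT.box₁ r₁ hT.bottom.1 (.inl hE.corner),
    isCycleSet_extendSet hE.cycle₂ hT.cycle₂ hE.box₂ hT.box₂ r₂ hT.bottom.2 (.inr hT₂),
    inBox_extendSet hE.box₁ hT.box₁ hk r₁, inBox_extendSet hE.box₂ hT.box₂ hk r₂,
    fun f hf => corner_notMem_extendSet hE.box₁ hT.corner hf, fun x y => ?_, fun x y => ?_,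
    ?_, ?_, ?_, ?_⟩
  · by_cases hx : x < k + 2
    · have key : ∀ {E T}, InBox (k + 2) (k + 2) E → InBox 3 3 T →
          (hEdge x y ∈ extendSet k E T ↔ hEdge x y ∈ E) := by
        intro E T bE bT
        have := fun h => bT.hEdge (x := x - (k + 1)) (y := y - (k + 1)) h
        rw [hEdge_mem_extendSet bE]
        constructor
        · rintro (h | h | h | h)
          · exact h
          · omega
          · omega
          · have := this h.1; omega
        · exact .inl
      rw [dif_congr (key hE.box₁ hT.box₁) (key hE.box₂ hT.box₂), hE.horiz]
      simp only [diagH]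
      congr 2 <;> simp only [eq_iff_iff] <;> omega
    -- These are edges of the connection, added to both cycles, together with the bottom edge of the
    -- block that is removed from both.
    by_cases hN : (x = k + 2 ∧ (y = k ∨ y = k + 1)) ∨ (x = k + 3 ∧ (y = k ∨ y = k + 2))
    · rw [dif_eq_zero, diagH, if_neg (by omega), if_neg (by omega), sub_zero]
      have b₁ := fun h => hE.box₁.hEdge (x := x) (y := y) h
      have b₂ := fun h => hE.box₂.hEdge (x := x) (y := y) h
      rw [hEdge_mem_extendSet hE.box₁, hEdge_mem_extendSet hE.box₂]
      constructor <;> rintro (h | h | h | h)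
      · have := b₁ h; omega
      · exact .inr (.inl h)
      · exact .inr (.inr (.inl h))
      · have := hT.box₁.hEdge h.1; omega
      · have := b₂ h; omega
      · exact .inr (.inl h)
      · exact .inr (.inr (.inl h))
      · have := hT.box₂.hEdge h.1; omega
    · have key : ∀ {E T}, InBox (k + 2) (k + 2) E →
          (hEdge x y ∈ extendSet k E T ↔ hEdge (x - (k + 1)) (y - (k + 1)) ∈ T) := by
        intro E T bE
        rw [hEdge_mem_extendSet bE]
        constructor
        · rintro (h | h | h | h)
          · have := bE.hEdge h; omega
          · omega
          · omega
          · exact h.1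
        · exact fun h => .inr (.inr (.inr ⟨h, by omega⟩))
      rw [dif_congr (key hE.box₁) (key hE.box₂), hT.horiz]
      simp only [diagH]
      congr 2 <;> simp only [eq_iff_iff] <;> omega
  · by_cases hA : x = k + 2 ∧ y = k
    · obtain ⟨rfl, rfl⟩ := hA
      have key : ∀ {E T}, InBox (y + 2) (y + 2) E → InBox 3 3 T →
          ¬ vEdge (y + 2) y ∈ extendSet y E T := by
        intro E T bE bT
        rw [vEdge_mem_extendSet bE]
        rintro (h | h | h | h)
        · exact h.2 ⟨rfl, rfl⟩
        · omega
        · omega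
        · have := bT.vEdge h; omega
      rw [dif_eq_zero (iff_of_false (key hE.box₁ hT.box₁) (key hE.box₂ hT.box₂)), diagH,
        if_neg (by omega), if_neg (by omega), sub_zero]
    by_cases hy : y < k + 2
    · by_cases hN : (x = k + 4 ∧ (y = k ∨ y = k + 1)) ∨ (x = k + 3 ∧ y = k + 1)
      · have key : ∀ {E T}, InBox (k + 2) (k + 2) E → vEdge x y ∈ extendSet k E T := by
          intro E T bE
          rw [vEdge_mem_extendSet bE]
          omega
        rw [dif_eq_zero (iff_of_true (key hE.box₁) (key hE.box₂)), diagH,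
          if_neg (by omega), if_neg (by omega), sub_zero]
      · have key : ∀ {E T}, InBox (k + 2) (k + 2) E → InBox 3 3 T →
            (vEdge x y ∈ extendSet k E T ↔ vEdge x y ∈ E) := by
          intro E T bE bT
          rw [vEdge_mem_extendSet bE]
          constructor
          · rintro (h | h | h | h)
            · exact h.1
            · omega
            · omega
            · have := bT.vEdge h; omega
          · exact fun h => .inl ⟨h, hA⟩
        rw [dif_congr (key hE.box₁ hT.box₁) (key hE.box₂ hT.box₂), hE.vert]
        simp only [diagH]
        congr 2 <;> simp only [eq_iff_iff] <;> omega
    · have key : ∀ {E T}, InBox (k + 2) (k + 2) E →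
          (vEdge x y ∈ extendSet k E T ↔ vEdge (x - (k + 1)) (y - (k + 1)) ∈ T) := by
        intro E T bE
        rw [vEdge_mem_extendSet bE]
        constructor
        · rintro (h | h | h | h)
          · have := bE.vEdge h.1; omega
          · omega
          · omega
          · exact h
        · exact fun h => .inr (.inr (.inr h))
      rw [dif_congr (key hE.box₁) (key hE.box₂), hT.vert]
      simp only [diagH]
      congr 2 <;> simp only [eq_iff_iff] <;> omega
  · rw [vEdge_mem_extendSet hE.box₁, vEdge_mem_extendSet hE.box₂]
    exact ⟨.inl ⟨hE.left.1, by omega⟩, .inl ⟨hE.left.2, by omega⟩⟩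
  · rw [hEdge_mem_extendSet hE.box₁, hEdge_mem_extendSet hE.box₂]
    exact ⟨.inl hE.bottom.1, .inl hE.bottom.2⟩
  · rw [vEdge_mem_extendSet hE.box₁, vEdge_mem_extendSet hE.box₂,
      show k + 2 + 2 - (k + 1) = 3 by ring, show k + 2 + 2 - 2 - (k + 1) = 3 - 2 by ring]
    exact ⟨.inr (.inr (.inr hT.right.1)), .inr (.inr (.inr hT.right.2))⟩
  · rw [hEdge_mem_extendSet hE.box₁, hEdge_mem_extendSet hE.box₂,
      show k + 2 + 2 - (k + 1) = 3 by ring, show k + 2 + 2 - 2 - (k + 1) = 3 - 2 by ring]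
    exact ⟨.inr (.inr (.inr ⟨hT.top.1, by omega⟩)), .inr (.inr (.inr ⟨hT.top.2, by omega⟩))⟩

theorem exists_diagonalPair (j : ℕ) : ∃ E₁ E₂, DiagonalPair (2 * j + 3) E₁ E₂ := by
  induction j with
  | zero => exact ⟨_, _, diagonalPair_three⟩
  | succ j ih =>
    obtain ⟨E₁, E₂, h⟩ := ih
    rw [show (2 * j + 3 : ℤ) = (2 * j + 1) + 2 by ring] at h
    have := h.extend (by omega) diagonalPair_three fun f hf hp =>
      absurd (mem_of_mem_loopEdges hf hp) (by decide +kernel)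
    rw [show (2 * ((j + 1 : ℕ) : ℤ) + 3) = 2 * j + 1 + 2 + 2 by push_cast; ring]
    exact ⟨_, _, this⟩

theorem exists_ambiguous_of_odd {e P Q : ℕ} (he : 3 ≤ e) (hodd : e % 2 = 1) (hP : 1 ≤ P)
    (hQ : 1 ≤ Q) : ∃ S₁ S₂, Ambiguous ((P * e : ℕ) : ℤ) ((Q * e : ℕ) : ℤ) S₁ S₂ := by
  obtain ⟨E₁, E₂, h⟩ := exists_diagonalPair ((e - 3) / 2)
  rw [show (2 * ((e - 3) / 2 : ℕ) + 3 : ℤ) = e by omega] at h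
  rw [Nat.cast_mul, Nat.cast_mul]
  exact (h.ambiguous (by omega)).tile (by omega) (by omega) h.left.1 h.left.2 h.right.1 h.right.2
    h.bottom.1 h.bottom.2 h.top.1 h.top.2 hP hQ

/-! ### Assembling the existence statement -/

theorem Ambiguous.exists_subgraphs {m n : ℕ} {E₁ E₂ : Set (Sym2 (ℤ × ℤ))}
    (h : Ambiguous m n E₁ E₂) : ∃ C₁ C₂ : lattice.Subgraph,
      IsGridCycle m n C₁ ∧ IsGridCycle m n C₂ ∧ C₁ ≠ C₂ ∧ signature m n C₁ = signature m n C₂ := by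
  have key : ∀ {E : Set (Sym2 (ℤ × ℤ))}, IsCycleSet lattice E → InBox m n E →
      ∃ C : lattice.Subgraph, IsGridCycle m n C ∧ C.edgeSet = E := by
    rintro E ⟨v, w, hw, rfl⟩ hb
    refine ⟨w.toSubgraph, ⟨⟨fun p hp => ?_, fun p q hpq => ?_⟩, v, w, hw, rfl⟩,
      w.edgeSet_toSubgraph⟩
    · rw [Walk.mem_verts_toSubgraph,
        Walk.mem_support_iff_exists_mem_edges_of_not_nil hw.not_nil] at hp
      obtain ⟨e, he, hp⟩ := hp
      exact hb e he p hp
    · have he : s(p, q) ∈ w.edgeSet := by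
        rw [← w.edgeSet_toSubgraph]; exact hpq
      exact ⟨hb _ he p (Sym2.mem_mk_left _ _), hb _ he q (Sym2.mem_mk_right _ _),
        w.toSubgraph.adj_sub hpq⟩
  obtain ⟨C₁, hC₁, rfl⟩ := key h.cycle₁ h.box₁
  obtain ⟨C₂, hC₂, rfl⟩ := key h.cycle₂ h.box₂
  refine ⟨C₁, C₂, hC₁, hC₂, ?_, signature_eq_iff.2 fun x y h1 h2 h3 h4 => ?_⟩
  · rintro rfl
    obtain ⟨x, y, hxy⟩ := h.ne
    simp [dif] at hxy
  · have := h.sig x y h1 h2 h3 h4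
    simp only [dif] at this
    simp only [cellSum]
    omega

theorem exists_ambiguous {m n : ℕ} (hm : 3 ≤ m) (hn : 3 ≤ n) (hd : 2 ≤ Nat.gcd m n)
    (h4 : Nat.gcd m n = 2 → m ≡ 0 [MOD 4] ∨ n ≡ 0 [MOD 4]) : ∃ S₁ S₂, Ambiguous m n S₁ S₂ := by
  -- An odd divisor of the gcd allows tiling by odd squares; otherwise the gcd is a power of two,
  -- and one dimension is divisible by four while the other is even.
  by_cases hodd : ∃ e, 3 ≤ e ∧ e % 2 = 1 ∧ e ∣ Nat.gcd m n
  · obtain ⟨e, he, he2, hed⟩ := hodd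
    obtain ⟨P, rfl⟩ := hed.trans (Nat.gcd_dvd_left m n)
    obtain ⟨Q, rfl⟩ := hed.trans (Nat.gcd_dvd_right _ n)
    rw [mul_comm e P, mul_comm e Q]
    exact exists_ambiguous_of_odd he he2 (Nat.pos_of_ne_zero (by rintro rfl; omega))
      (Nat.pos_of_ne_zero (by rintro rfl; omega))
  · obtain ⟨k, hk⟩ := Nat.exists_eq_two_pow_mul_odd (n := Nat.gcd m n) (by omega)
    obtain ⟨e, he, hg⟩ := hk
    have he1 : e = 1 := by
      by_contra hne
      obtain ⟨r, hr⟩ := id he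
      exact hodd ⟨e, by omega, by omega, hg ▸ Dvd.intro_left _ rfl⟩
    rw [he1, mul_one] at hg
    have hmd := Nat.gcd_dvd_left m n
    have hnd := Nat.gcd_dvd_right m n
    have hmn : (m % 4 = 0 ∧ n % 2 = 0) ∨ (n % 4 = 0 ∧ m % 2 = 0) := by
      match k with
      | 0 => omega
      | 1 =>
        have := h4 (by omega)
        rw [hg] at hmd hnd
        simp only [Nat.ModEq] at this
        omega
      | k + 2 =>
        have h4d : 4 ∣ Nat.gcd m n := ⟨2 ^ k, by rw [hg]; ring⟩
        have := h4d.trans hmd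
        have := h4d.trans hnd
        omega
    rcases hmn with ⟨h1, h2⟩ | ⟨h1, h2⟩
    · exact exists_ambiguous_of_even hm hn h1 h2
    · obtain ⟨S₁, S₂, h⟩ := exists_ambiguous_of_even hn hm h1 h2
      exact ⟨_, _, h.transpose⟩

end Slitherlink

theorem theorem6p1 (m n : ℕ) (hm : 0 < m) (hn : 0 < n) :
    ((∀ C₁ C₂ : Slitherlink.lattice.Subgraph,
        Slitherlink.IsGridCycle m n C₁ → Slitherlink.IsGridCycle m n C₂ →
        Slitherlink.signature m n C₁ = Slitherlink.signature m n C₂ → C₁ = C₂) ↔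
      (m ≤ 2 ∨ n ≤ 2) ∨ Nat.gcd m n = 1 ∨
        (Nat.gcd m n = 2 ∧ m ≡ 2 [MOD 4] ∧ n ≡ 2 [MOD 4])) ∧
    ((∃ C₁ C₂ : Slitherlink.lattice.Subgraph,
        Slitherlink.IsGridCycle m n C₁ ∧ Slitherlink.IsGridCycle m n C₂ ∧ C₁ ≠ C₂ ∧
        Slitherlink.signature m n C₁ = Slitherlink.signature m n C₂) ↔
      (3 ≤ m ∧ 3 ≤ n) ∧ 2 ≤ Nat.gcd m n ∧
        (Nat.gcd m n = 2 → m ≡ 0 [MOD 4] ∨ n ≡ 0 [MOD 4])) := by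
  have hd : 0 < Nat.gcd m n := Nat.gcd_pos_of_pos_left _ hm
  have hcond : ((m ≤ 2 ∨ n ≤ 2) ∨ Nat.gcd m n = 1 ∨
      (Nat.gcd m n = 2 ∧ m ≡ 2 [MOD 4] ∧ n ≡ 2 [MOD 4])) ↔
      ¬((3 ≤ m ∧ 3 ≤ n) ∧ 2 ≤ Nat.gcd m n ∧
        (Nat.gcd m n = 2 → m ≡ 0 [MOD 4] ∨ n ≡ 0 [MOD 4])) := by
    have h2 : Nat.gcd m n = 2 → m % 2 = 0 ∧ n % 2 = 0 := fun h =>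
      ⟨Nat.mod_eq_zero_of_dvd (h ▸ Nat.gcd_dvd_left m n),
        Nat.mod_eq_zero_of_dvd (h ▸ Nat.gcd_dvd_right m n)⟩
    simp only [Nat.ModEq]
    omega
  have hex : (3 ≤ m ∧ 3 ≤ n) ∧ 2 ≤ Nat.gcd m n ∧
      (Nat.gcd m n = 2 → m ≡ 0 [MOD 4] ∨ n ≡ 0 [MOD 4]) →
      ∃ C₁ C₂ : Slitherlink.lattice.Subgraph,
        Slitherlink.IsGridCycle m n C₁ ∧ Slitherlink.IsGridCycle m n C₂ ∧ C₁ ≠ C₂ ∧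
        Slitherlink.signature m n C₁ = Slitherlink.signature m n C₂ := by
    rintro ⟨⟨h1, h2⟩, h3, h4⟩
    obtain ⟨S₁, S₂, h⟩ := Slitherlink.exists_ambiguous h1 h2 h3 h4
    exact h.exists_subgraphs
  refine ⟨⟨fun h => hcond.2 fun h' => ?_, fun h C₁ C₂ hC₁ hC₂ hs =>
    Slitherlink.eq_of_signature_eq hm hn h hC₁ hC₂ hs⟩, ⟨fun h => ?_, hex⟩⟩
  · obtain ⟨C₁, C₂, hC₁, hC₂, hne, hs⟩ := hex h'
    exact hne (h C₁ C₂ hC₁ hC₂ hs)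
  · obtain ⟨C₁, C₂, hC₁, hC₂, hne, hs⟩ := h
    by_contra h'
    exact hne (Slitherlink.eq_of_signature_eq hm hn (hcond.2 h') hC₁ hC₂ hs)
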